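/- Let $d\ge 1$ be an integer and $0<\gamma\le 1$. A convex body (compact convex set) $K\subset\mathbb{R}^d$ is in \emph{$\gamma$-canonical form} if $\sqrt{\gamma}\,B_0\subseteq K\subseteq B_0/\sqrt{\gamma}$, where $B_0$ is the closed unit ball centered at the origin $O$. Its polar is $K^*=\{y:\langle y,p\rangle\le 1\text{ for all }p\in K\}$. A \emph{cap} of a convex body is its nonempty intersection with a closed halfspace; its \emph{base} is the intersection of the body with the bounding hyperplane $g$ of the halfspace, and its \emph{width} is the distance from $g$ to the supporting hyperplane of the body that is parallel to $g$ and lies on the side of the cap. The polar of a hyperplane not containing $O$ is the point $z$ such that the hyperplane equals $\{p:\langle z,p\rangle=1\}$. There is a constant $c_0>0$, depending only on $d$ and $\gamma$, such that for every $c\ge c_0$ there are constants $c_1,c_2,c_3,c_4>0$, depending only on $d,\gamma,c$, with the following property. Let $K\subset\mathbb{R}^d$ be a convex body in $\gamma$-canonical form, let $v$ be a unit vector (the vertical direction), let $\varepsilon>0$, and let $C=K\cap\{p:\langle v,p\rangle\ge a\}$ with $a>0$ be a cap of $K$ of width $\varepsilon$ (so its base is orthogonal to $v$ and lies strictly above $O$).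 Then there are a point $x\in K^*$ on the ray from $O$ in direction $v$ whose distance to $\partial K^*$ is $\varepsilon/c$ and a cap $\pi(C)$ of $K^*$ that has minimum volume among all caps of $K^*$ containing $x$. For every such choice of $x$ and $\pi(C)$ the following hold. (i) Let $X\subset v^\perp$ be the orthogonal projection of the base of $\pi(C)$ to $v^\perp$, and let $X^*=\{y\in v^\perp:\langle y,p\rangle\le 1\text{ for all }p\in X\}$ be its polar inside $v^\perp$. Let $z$ be the polar of the hyperplane $\{p:\langle v,p\rangle=a\}$ that contains the base of $C$, and let $h$ be the hyperplane through $z$ parallel to the base of $\pi(C)$. Then $h$ does not contain $O$, and its polar point $h^*$ satisfies $$c_1\,\varepsilon\,X^*\;\subseteq\;\mathrm{base}(C)-h^*\;\subseteq\;c_2\,\varepsilon\,X^*.$$ (ii) $c_3\,\varepsilon^{d+1}\le \mathrm{vol}(C)\cdot\mathrm{vol}(\pi(C))\le c_4\,\varepsilon^{d+1}$. -/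

import Mathlib

open scoped Pointwise RealInnerProductSpace

namespace PolarCaps

variable {d : ℕ}

/-- `K` is in `γ`-canonical form: `√γ B₀ ⊆ K ⊆ B₀ / √γ`, where `B₀` is the unit ball centered at
the origin. -/
def IsCanonical (γ : ℝ) (K : Set (EuclideanSpace ℝ (Fin d))) : Prop :=
  Metric.closedBall 0 (√γ) ⊆ K ∧ K ⊆ Metric.closedBall 0 (1 / √γ)

/-- The polar `K* = {y : ⟪y, p⟫ ≤ 1 for all p ∈ K}` (one-sided, unlike Mathlib's absolute polar). -/
def polar (K : Set (EuclideanSpace ℝ (Fin d))) : Set (EuclideanSpace ℝ (Fin d)) :=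
  {y | ∀ p ∈ K, ⟪y, p⟫ ≤ 1}

/-- The hyperplane with normal `u` at height `t`. -/
def hyperplane (u : EuclideanSpace ℝ (Fin d)) (t : ℝ) : Set (EuclideanSpace ℝ (Fin d)) :=
  {p | ⟪u, p⟫ = t}

/-- The polar `z*` of a point `z ≠ 0`: the hyperplane orthogonal to `z` at distance `1 / ‖z‖` from
the origin, on the same side of the origin as `z`. The polar of a hyperplane avoiding the origin is
the point `z` with `z*` equal to this hyperplane. -/
def pointPolar (z : EuclideanSpace ℝ (Fin d)) : Set (EuclideanSpace ℝ (Fin d)) :=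
  {p | ⟪z, p⟫ = 1}

/-- The cap of `K` cut off by the halfspace `{p : t ≤ ⟪u, p⟫}` (used for unit vectors `u`). -/
def cap (K : Set (EuclideanSpace ℝ (Fin d))) (u : EuclideanSpace ℝ (Fin d)) (t : ℝ) :
    Set (EuclideanSpace ℝ (Fin d)) :=
  K ∩ {p | t ≤ ⟪u, p⟫}

/-- The base of the cap `cap K u t`. -/
def capBase (K : Set (EuclideanSpace ℝ (Fin d))) (u : EuclideanSpace ℝ (Fin d)) (t : ℝ) :
    Set (EuclideanSpace ℝ (Fin d)) :=
  hyperplane u t ∩ K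

/-- The width of the cap `cap K u t`, for a unit vector `u`: the distance from the hyperplane of
its base to the parallel supporting hyperplane of `K` on the side of `u`. -/
noncomputable def capWidth (K : Set (EuclideanSpace ℝ (Fin d))) (u : EuclideanSpace ℝ (Fin d))
    (t : ℝ) : ℝ :=
  sSup ((fun p => ⟪u, p⟫) '' K) - t

/-- `cap K u t` has minimum volume among all caps of `K` that contain `x`. -/
def IsMinimalCap (K : Set (EuclideanSpace ℝ (Fin d))) (x u : EuclideanSpace ℝ (Fin d)) (t : ℝ) :
    Prop :=
  ‖u‖ = 1 ∧ x ∈ cap K u t ∧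
    ∀ (u' : EuclideanSpace ℝ (Fin d)) (t' : ℝ), ‖u'‖ = 1 → x ∈ cap K u' t' →
      MeasureTheory.volume (cap K u t) ≤ MeasureTheory.volume (cap K u' t')

/-- `cap (polar K) u t` is an admissible choice of `π(C)` for a cap `C` of `K` of width `ε`
orthogonal to the unit vector `v`: it is a minimum volume cap of `K*` that contains a point `x ∈ K*`
on the ray from the origin in direction `v` at distance `ε / c` from the boundary of `K*`. -/
def IsAssociatedCap (c ε : ℝ) (K : Set (EuclideanSpace ℝ (Fin d)))
    (v u : EuclideanSpace ℝ (Fin d)) (t : ℝ) : Prop :=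
  ∃ x ∈ polar K, (∃ s : ℝ, 0 ≤ s ∧ x = s • v) ∧
    Metric.infDist x (frontier (polar K)) = ε / c ∧ IsMinimalCap (polar K) x u t

/-- The projection of a set along `v` to the hyperplane `v^⊥` through the origin. -/
noncomputable def verticalProj (v : EuclideanSpace ℝ (Fin d))
    (S : Set (EuclideanSpace ℝ (Fin d))) : Set (EuclideanSpace ℝ (Fin d)) :=
  (fun p => (Submodule.span ℝ {v})ᗮ.starProjection p) '' S

/-- The polar of a subset `X` of the `(d - 1)`-dimensional space `v^⊥`, taken inside `v^⊥`. -/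
def horizontalPolar (v : EuclideanSpace ℝ (Fin d)) (X : Set (EuclideanSpace ℝ (Fin d))) :
    Set (EuclideanSpace ℝ (Fin d)) :=
  {y | ⟪v, y⟫ = 0 ∧ ∀ p ∈ X, ⟪y, p⟫ ≤ 1}

end PolarCaps

/-!
Let `C` be a cap of `K` in direction `v`, of width `ε` and with base at height `a`, let `H = a + ε`
be the maximal height of `K`, and let `π(C)` be a minimum volume cap of `L = polar K` containing a
point `x = s v` at distance `ε / c` from the boundary. Such a point exists by the intermediate value
theorem, and such a cap by compactness of the unit sphere and continuity of the volume cut off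
(`IsSupported.exists_isAssociatedCap`). The duality between `C` and `π(C)` has three sources; `X`
denotes the projection of the base of `π(C)` along `v`.

*Thinness.* A minimum volume cap is balanced (`IsMinimalCap.balanced`): if its base extends by `η`
from `x` in some direction, then it extends by at most a constant times `η` in the opposite
direction. This replaces the fact that `x` is the centroid of the base and is proved without
differentiating the volume: if it failed, an explicit affine map that doubles volumes would send
what a small rotation of the halfspace gains into what it loses. Balance in the direction of the
outer normal of `L` at the end `v / H` of the vertical axis shows that the width of `π(C)` is at
most a constant times the depth of `x`, that is, of order `ε / c` (`IsMinimalCap.isThinCap`).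

*Polarity of the bases.* Let `w` be the polar of the hyperplane through `v / a` parallel to the base
of `π(C)`. A point `w + q` with `q ⟂ v` lies in `K` iff `⟪q, y⟫ ≤ 1 - ⟪w, y⟫` for all `y ∈ L`. On
the base of `π(C)` the right-hand side is constant and of order `ε`, which gives
`base(C) - w ⊆ c₂ ε X*`. Conversely, an inequality `⟪q, y⟫ ≤ c₁ ε` on the base extends to `L` by
central projection from the origin and from `v / H`, as `⟪q, ·⟫` vanishes at both points and the
right-hand side is still of order `ε` on the whole thin cap when `c` is large
(`IsThinCap.sub_mem_smul_horizontalPolar`, `IsThinCap.add_mem_of_mem_horizontalPolar`).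

*Volumes.* A cap has, up to constants, the volume of its width times the prism over its base
(`volume_cap_le_prism`, `prism_le_volume_cap`). By the polarity of the bases, `vol C` is of the order
of `ε ^ d` times the volume of the prism over `X*`, and `vol π(C)` of the order of `ε` times the
volume of the prism over `X`. These prisms are polar to each other up to a factor `2`, and the
product of the volumes of a body and its polar is bounded from below, and, for balanced bodies,
from above. With crude constants both bounds follow from a frame of maximal determinant in the body
(`le_volume_mul_volume_polar`, `volume_mul_volume_polar_le`).
-/

namespace PolarCaps

open MeasureTheory Set Metric

variable {d : ℕ}

local notation "𝔼" => EuclideanSpace ℝ (Fin d)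

/-! ### Rank-one perturbations of homotheties -/

/-- The linear map `y ↦ α y + ⟪n, y⟫ f`. All affine maps between caps used below have a linear
part of this form, whose determinant is explicit. -/
noncomputable def rankOneMap (α : ℝ) (n f : 𝔼) : 𝔼 →ₗ[ℝ] 𝔼 :=
  α • LinearMap.id + (innerₗ 𝔼 n).smulRight f

lemma rankOneMap_apply (α : ℝ) (n f y : 𝔼) : rankOneMap α n f y = α • y + ⟪n, y⟫ • f := by
  simp [rankOneMap]

lemma det_rankOneMap {α : ℝ} (hα : α ≠ 0) (n f : 𝔼) :
    LinearMap.det (rankOneMap α n f) = α ^ d * (1 + ⟪n, f⟫ / α) := by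
  have h : rankOneMap α n f = α • LinearMap.transvection (innerₗ 𝔼 n) (α⁻¹ • f) := by
    ext1 y
    simp only [rankOneMap_apply, LinearMap.smul_apply, LinearMap.transvection.apply, smul_add,
      innerₗ_apply_apply, smul_smul]
    rw [mul_left_comm, mul_inv_cancel₀ hα, mul_one]
  rw [h, LinearMap.det_smul, LinearMap.transvection.det]
  simp only [finrank_euclideanSpace, Fintype.card_fin, innerₗ_apply_apply, inner_smul_right]
  ring

lemma volume_image_rankOneMap {α : ℝ} (hα : α ≠ 0) (n f : 𝔼) (S : Set 𝔼) :
    volume (rankOneMap α n f '' S) =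
      ENNReal.ofReal |α ^ d * (1 + ⟪n, f⟫ / α)| * volume S := by
  rw [Measure.addHaar_image_linearMap, det_rankOneMap hα]

/-! ### The volume product of a convex body and its polar -/

lemma volume_coordBox {s t : ℝ} (hst : s ≤ t) :
    volume {y : 𝔼 | ∀ i, s ≤ y i ∧ y i ≤ t} = ENNReal.ofReal ((t - s) ^ d) := by
  have h : {y : 𝔼 | ∀ i, s ≤ y i ∧ y i ≤ t} =
      (WithLp.ofLp : 𝔼 → (Fin d → ℝ)) ⁻¹' Icc (fun _ => s) (fun _ => t) := by
    ext y
    simp [Pi.le_def, forall_and]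
  rw [h, (PiLp.volume_preserving_ofLp (Fin d)).measure_preimage
    measurableSet_Icc.nullMeasurableSet, Real.volume_Icc_pi]
  simp [ENNReal.ofReal_pow (sub_nonneg.2 hst)]

/-- The linear map sending the standard basis to the vectors `p i`. -/
noncomputable def frameMap (p : Fin d → 𝔼) : 𝔼 →ₗ[ℝ] 𝔼 :=
  (EuclideanSpace.basisFun (Fin d) ℝ).toBasis.constr ℝ p

lemma frameMap_apply (p : Fin d → 𝔼) (y : 𝔼) : frameMap p y = ∑ i, y i • p i := by
  simp [frameMap, Module.Basis.constr_apply_fintype]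

lemma adjoint_frameMap_apply (p : Fin d → 𝔼) (y : 𝔼) (i : Fin d) :
    LinearMap.adjoint (frameMap p) y i = ⟪y, p i⟫ := by
  have h := LinearMap.adjoint_inner_left (frameMap p) (EuclideanSpace.single i 1) y
  simpa [frameMap_apply, EuclideanSpace.inner_single_right, PiLp.single_apply] using h

lemma det_frameMap (p : Fin d → 𝔼) :
    LinearMap.det (frameMap p) = (EuclideanSpace.basisFun (Fin d) ℝ).toBasis.det p := by
  rw [Module.Basis.det_apply, ← LinearMap.det_toMatrix (EuclideanSpace.basisFun (Fin d) ℝ).toBasis]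
  congr 1
  ext i j
  simp [LinearMap.toMatrix_apply, Module.Basis.toMatrix_apply, frameMap]

lemma det_adjoint_linearMap (f : 𝔼 →ₗ[ℝ] 𝔼) :
    LinearMap.det (LinearMap.adjoint f) = LinearMap.det f := by
  have b := EuclideanSpace.basisFun (Fin d) ℝ
  rw [← LinearMap.det_toMatrix b.toBasis, ← LinearMap.det_toMatrix b.toBasis f,
    LinearMap.toMatrix_adjoint, Matrix.det_conjTranspose]
  simp

/-- A compact set with interior contains a frame of maximal determinant, and by Cramer's rule all
points of the set have coordinates in `[-1, 1]` with respect to this frame. -/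
lemma exists_maximal_frame {P : Set 𝔼} (hP : IsCompact P) {r : ℝ} (hr : 0 < r)
    (hrP : closedBall 0 r ⊆ P) :
    ∃ p : Fin d → 𝔼, (∀ i, p i ∈ P) ∧ LinearMap.det (frameMap p) ≠ 0 ∧
      ∀ q ∈ P, ∃ y : 𝔼, (∀ i, |y i| ≤ 1) ∧ frameMap p y = q := by
  set e := (EuclideanSpace.basisFun (Fin d) ℝ).toBasis with he
  have hmem : (fun i => r • e i) ∈ Set.pi univ (fun _ : Fin d => P) := by
    intro i _
    apply hrP
    simp [he, norm_smul, abs_of_pos hr]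
  have hcont : Continuous fun p : Fin d → 𝔼 => |e.det p| := by
    simp only [Module.Basis.det_apply]
    refine (Continuous.matrix_det ?_).abs
    refine continuous_pi fun i => continuous_pi fun j => ?_
    simp only [Module.Basis.toMatrix_apply, he, OrthonormalBasis.coe_toBasis_repr_apply,
      EuclideanSpace.basisFun_repr]
    fun_prop
  obtain ⟨p, hpP, hpmax⟩ := (isCompact_univ_pi fun _ : Fin d => hP).exists_isMaxOn ⟨_, hmem⟩
    hcont.continuousOn
  have hdet : e.det p ≠ 0 := by
    have h1 : |e.det fun i => r • e i| ≤ |e.det p| := hpmax hmem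
    have h2 : (e.det fun i => r • e i) = r ^ d := by
      have := e.det.map_smul_univ (fun _ => r) e
      simpa [Module.Basis.det_self] using this
    rw [h2, abs_of_pos (pow_pos hr d)] at h1
    exact abs_pos.1 ((pow_pos hr d).trans_le h1)
  refine ⟨p, fun i => hpP i (mem_univ i), by rwa [det_frameMap], fun q hq => ?_⟩
  have hu : IsUnit (LinearMap.det (frameMap p)) := by
    rw [det_frameMap]; exact isUnit_iff_ne_zero.2 hdet
  obtain ⟨y, hy⟩ :=
    ((Module.End.isUnit_iff _).1 ((LinearMap.isUnit_iff_isUnit_det _).2 hu)).surjective q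
  refine ⟨y, fun i => ?_, hy⟩
  have hupd : e.det (Function.update p i q) = y i * e.det p := by
    rw [← hy, frameMap_apply, AlternatingMap.map_update_sum, Finset.sum_eq_single i]
    · rw [AlternatingMap.map_update_smul, Function.update_eq_self, smul_eq_mul]
    · intro j _ hj
      rw [AlternatingMap.map_update_smul, e.det.map_update_self p hj.symm, smul_zero]
    · simp
  have hle : |e.det (Function.update p i q)| ≤ |e.det p| := by
    refine hpmax (a := Function.update p i q) ?_
    intro j _
    rcases eq_or_ne j i with rfl | hji
    · simpa using hq
    · simpa [hji] using hpP j (mem_univ j)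
  rw [hupd, abs_mul] at hle
  exact le_of_mul_le_mul_right (by simpa using hle) (abs_pos.2 hdet)

/-- Reverse Blaschke–Santaló inequality with a crude constant: with a maximal frame `p` of `P`, the
body `P` contains the parallelepiped spanned by the `p i / d`, and its polar contains the preimage
of the cube `[-1/d, 1/d]^d` under `y ↦ (⟪y, p i⟫)ᵢ`. -/
lemma le_volume_mul_volume_polar {P : Set 𝔼} (hd : 0 < d) (hP : IsCompact P) (hconv : Convex ℝ P)
    {r : ℝ} (hr : 0 < r) (hrP : closedBall 0 r ⊆ P) :
    ENNReal.ofReal ((1 / d) ^ d * (2 / d) ^ d) ≤ volume P * volume (polar P) := by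
  obtain ⟨p, hpP, hdet, hcoord⟩ := exists_maximal_frame hP hr hrP
  have hd' : (0 : ℝ) < d := by exact_mod_cast hd
  have h0 : (0 : 𝔼) ∈ P := hrP (by simp [hr.le])
  have h1 : frameMap p '' {y : 𝔼 | ∀ i, 0 ≤ y i ∧ y i ≤ 1 / d} ⊆ P := by
    rintro _ ⟨y, hy, rfl⟩
    rw [frameMap_apply]
    have h : ∀ i, y i • p i = (1 / d : ℝ) • ((d * y i) • p i) := by
      intro i
      rw [smul_smul]
      congr 1
      field_simp
    simp_rw [h]
    refine hconv.sum_mem (fun _ _ => by positivity) (by simp [hd'.ne']) fun i _ => ?_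
    refine hconv.smul_mem_of_zero_mem h0 (hpP i) ⟨mul_nonneg hd'.le (hy i).1, ?_⟩
    have := (hy i).2
    rwa [le_div_iff₀ hd', mul_comm] at this
  have h2 : LinearMap.adjoint (frameMap p) ⁻¹' {y : 𝔼 | ∀ i, -(1 / d) ≤ y i ∧ y i ≤ 1 / d} ⊆
      polar P := by
    intro y hy q hq
    obtain ⟨c, hc, rfl⟩ := hcoord q hq
    rw [frameMap_apply, inner_sum]
    calc ∑ i, ⟪y, c i • p i⟫ ≤ ∑ _i : Fin d, (1 / d : ℝ) := by
          refine Finset.sum_le_sum fun i _ => ?_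
          have h3 := hy i
          rw [adjoint_frameMap_apply] at h3
          rw [inner_smul_right]
          refine (le_abs_self _).trans ?_
          rw [abs_mul]
          calc |c i| * |⟪y, p i⟫| ≤ 1 * (1 / d) :=
                mul_le_mul (hc i) (abs_le.2 h3) (abs_nonneg _) zero_le_one
            _ = 1 / d := one_mul _
      _ = 1 := by simp [hd'.ne']
  have hdet' : LinearMap.det (LinearMap.adjoint (frameMap p)) ≠ 0 := by
    rwa [det_adjoint_linearMap]
  refine le_trans ?_ (mul_le_mul' (measure_mono h1) (measure_mono h2))
  rw [Measure.addHaar_image_linearMap, Measure.addHaar_preimage_linearMap _ hdet',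
    det_adjoint_linearMap, volume_coordBox (by positivity),
    volume_coordBox (by linarith [one_div_pos.2 hd']), ← ENNReal.ofReal_mul (abs_nonneg _),
    ← ENNReal.ofReal_mul (abs_nonneg _),
    ← ENNReal.ofReal_mul (mul_nonneg (abs_nonneg _) (by rw [sub_zero]; positivity))]
  refine ENNReal.ofReal_le_ofReal (le_of_eq ?_)
  have : |LinearMap.det (frameMap p)| ≠ 0 := abs_ne_zero.2 hdet
  rw [abs_inv]
  field_simp
  ring

/-- Blaschke–Santaló inequality with a crude constant, for bodies whose polar pairs with them
above `-κ`: with a maximal frame `p` of `P`, the body `P` is contained in the image of the cube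
`[-1, 1]^d`, and its polar in the preimage of the cube `[-κ, 1]^d` under `y ↦ (⟪y, p i⟫)ᵢ`. -/
lemma volume_mul_volume_polar_le {P : Set 𝔼} (hP : IsCompact P)
    {r : ℝ} (hr : 0 < r) (hrP : closedBall 0 r ⊆ P) {κ : ℝ} (hκ : 0 ≤ κ)
    (hbal : ∀ y ∈ polar P, ∀ q ∈ P, -κ ≤ ⟪y, q⟫) :
    volume P * volume (polar P) ≤ ENNReal.ofReal (2 ^ d * (κ + 1) ^ d) := by
  obtain ⟨p, hpP, hdet, hcoord⟩ := exists_maximal_frame hP hr hrP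
  have h1 : P ⊆ frameMap p '' {y : 𝔼 | ∀ i, -1 ≤ y i ∧ y i ≤ 1} := by
    intro q hq
    obtain ⟨y, hy, rfl⟩ := hcoord q hq
    exact ⟨y, fun i => abs_le.1 (hy i), rfl⟩
  have h2 : polar P ⊆
      LinearMap.adjoint (frameMap p) ⁻¹' {y : 𝔼 | ∀ i, -κ ≤ y i ∧ y i ≤ 1} := by
    intro y hy i
    rw [adjoint_frameMap_apply]
    exact ⟨hbal y hy _ (hpP i), hy _ (hpP i)⟩
  have hdet' : LinearMap.det (LinearMap.adjoint (frameMap p)) ≠ 0 := by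
    rwa [det_adjoint_linearMap]
  refine (mul_le_mul' (measure_mono h1) (measure_mono h2)).trans ?_
  rw [Measure.addHaar_image_linearMap, Measure.addHaar_preimage_linearMap _ hdet',
    det_adjoint_linearMap, volume_coordBox (by norm_num),
    volume_coordBox (by linarith), ← ENNReal.ofReal_mul (abs_nonneg _),
    ← ENNReal.ofReal_mul (abs_nonneg _), ← ENNReal.ofReal_mul (by positivity)]
  refine ENNReal.ofReal_le_ofReal (le_of_eq ?_)
  have : |LinearMap.det (frameMap p)| ≠ 0 := abs_ne_zero.2 hdet
  rw [abs_inv]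
  field_simp
  ring

/-! ### Minimum volume caps -/

lemma volume_image_rankOneMap_add {α : ℝ} (hα : α ≠ 0) (n f k : 𝔼) (S : Set 𝔼) :
    volume ((fun y => rankOneMap α n f y + k) '' S) =
      ENNReal.ofReal |α ^ d * (1 + ⟪n, f⟫ / α)| * volume S := by
  have h : (fun y => rankOneMap α n f y + k) '' S = k +ᵥ (rankOneMap α n f '' S) := by
    rw [← image_vadd, image_image]
    simp [add_comm]
  rw [h, measure_vadd, volume_image_rankOneMap hα]

lemma volume_lt_of_isOpen {A B U : Set 𝔼} (hA : A ⊆ B) (hU : U ⊆ B) (hAU : Disjoint A U)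
    (hopen : IsOpen U) (hne : U.Nonempty) (hfin : volume A ≠ ⊤) : volume A < volume B := by
  calc volume A < volume A + volume U :=
        ENNReal.lt_add_right hfin (hopen.measure_pos volume hne).ne'
    _ = volume (A ∪ U) := (measure_union hAU hopen.measurableSet).symm
    _ ≤ volume B := measure_mono (union_subset hA hU)

lemma isClosed_halfspace (m x : 𝔼) (t : ℝ) : IsClosed {y : 𝔼 | t ≤ ⟪m, y - x⟫} :=
  isClosed_le continuous_const (by fun_prop)

/-- Minimality of a cap may be tested on halfspaces whose normal is not normalised. -/
lemma IsMinimalCap.volume_le {L : Set 𝔼} {x u : 𝔼} {b : ℝ} (h : IsMinimalCap L x u b) (m : 𝔼) :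
    volume (cap L u b) ≤ volume (L ∩ {y | 0 ≤ ⟪m, y - x⟫}) := by
  rcases eq_or_ne m 0 with rfl | hm
  · refine measure_mono fun y hy => ⟨hy.1, ?_⟩
    simp
  have hm' : 0 < ‖m‖ := norm_pos_iff.2 hm
  refine (h.2.2 (‖m‖⁻¹ • m) ⟪‖m‖⁻¹ • m, x⟫ ?_ ⟨h.2.1.1, le_refl (⟪‖m‖⁻¹ • m, x⟫ : ℝ)⟩).trans ?_
  · simp [norm_smul, hm]
  · refine measure_mono fun y hy => ⟨hy.1, ?_⟩
    have h2 : ⟪‖m‖⁻¹ • m, x⟫ ≤ ⟪‖m‖⁻¹ • m, y⟫ := hy.2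
    rw [real_inner_smul_left, real_inner_smul_left] at h2
    have := le_of_mul_le_mul_left h2 (inv_pos.2 hm')
    simpa [inner_sub_right] using this

/-- Moving from an interior point in the direction of the unit vector `u` stays inside. -/
lemma exists_mem_interior_inner_lt {L : Set 𝔼} {x u : 𝔼} (hu : ‖u‖ = 1) (hx : x ∈ interior L)
    {t : ℝ} (ht : 0 < t) : ∃ p ∈ interior L, ⟪u, x⟫ < ⟪u, p⟫ ∧ ⟪u, p⟫ < ⟪u, x⟫ + t := by
  have hcont : Continuous fun τ : ℝ => x + τ • u := by fun_prop
  have h1 : ∀ᶠ τ in nhds (0 : ℝ), x + τ • u ∈ interior L :=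
    hcont.continuousAt.eventually_mem (by simpa using isOpen_interior.mem_nhds hx)
  have h2 : ∀ᶠ τ in nhds (0 : ℝ), τ < t := eventually_lt_nhds ht
  obtain ⟨τ, ⟨h1, h2⟩, h3⟩ := (((h1.and h2).filter_mono nhdsWithin_le_nhds).and
    (self_mem_nhdsWithin (a := (0 : ℝ)) (s := Ioi 0))).exists
  refine ⟨_, h1, ?_⟩
  have : ⟪u, x + τ • u⟫ = ⟪u, x⟫ + τ := by
    rw [inner_add_right, real_inner_smul_right, real_inner_self_eq_norm_sq, hu]; ring
  rw [this]
  exact ⟨lt_add_of_pos_right _ h3, by linarith⟩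

/-- The base of a minimum volume cap containing an interior point passes through that point. -/
lemma IsMinimalCap.inner_eq {L : Set 𝔼} (hL : IsCompact L) {x u : 𝔼} {b : ℝ}
    (h : IsMinimalCap L x u b) (hx : x ∈ interior L) : ⟪u, x⟫ = b := by
  obtain ⟨hu, hxc, hmin⟩ := h
  by_contra hne
  have hlt : b < ⟪u, x⟫ := lt_of_le_of_ne hxc.2 (Ne.symm hne)
  refine (hmin u ⟪u, x⟫ hu ⟨hxc.1, le_refl (⟪u, x⟫ : ℝ)⟩).not_gt ?_
  refine volume_lt_of_isOpen (U := interior L ∩ {y | b < ⟪u, y⟫ ∧ ⟪u, y⟫ < ⟪u, x⟫})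
    ?_ ?_ ?_ ?_ ?_ ?_
  · exact fun y hy => ⟨hy.1, hlt.le.trans hy.2⟩
  · exact fun y hy => ⟨interior_subset hy.1, hy.2.1.le⟩
  · rw [Set.disjoint_left]
    rintro y ⟨_, hy1⟩ ⟨_, _, hy2⟩
    exact (lt_irrefl _ (hy2.trans_le hy1)).elim
  · exact isOpen_interior.inter (isOpen_Ioo.preimage (innerSL ℝ u).continuous)
  · obtain ⟨p, hp, hp1, hp2⟩ := exists_mem_interior_inner_lt (u := -u) (by simpa using hu) hx
      (sub_pos.2 hlt)
    simp only [inner_neg_left] at hp1 hp2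
    exact ⟨p, hp, by constructor <;> linarith⟩
  · exact ((measure_mono inter_subset_left).trans_lt hL.measure_lt_top).ne

lemma convex_add_add_mem {L : Set 𝔼} (hconv : Convex ℝ L) {x y z : 𝔼} (hx : x ∈ L) (hy : y ∈ L)
    (hz : z ∈ L) {a b c : ℝ} (ha : 0 ≤ a) (hb : 0 ≤ b) (hc : 0 ≤ c) (habc : a + b + c = 1) :
    a • x + b • y + c • z ∈ L := by
  have := hconv.sum_mem (t := Finset.univ) (w := ![a, b, c]) (z := ![x, y, z])
    (by simp [Fin.forall_fin_succ, ha, hb, hc]) (by simpa [Fin.sum_univ_three] using habc)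
    (by simp [Fin.forall_fin_succ, hx, hy, hz])
  simpa [Fin.sum_univ_three] using this

set_option maxHeartbeats 1000000 in
/-- Minimum volume caps are balanced: if the base, seen from `x`, extends by at most `η` in
direction `n`, then it extends by at most a constant times `η` in direction `-n`.

Otherwise let `y₁` be a base point far out in direction `-n`, and rotate the halfspace slightly
about the flat `{⟪u, · - x⟫ = ⟪n, · - x⟫ = 0}`. An affine map that reflects across the base
hyperplane and contracts towards `y₁` along it sends the wedge gained by the rotation into the
wedge lost, and it doubles volumes. Hence the rotated cap is smaller. -/
lemma IsMinimalCap.balanced {L : Set 𝔼} (hL : IsCompact L) (hconv : Convex ℝ L) {x u : 𝔼} {b : ℝ}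
    (h : IsMinimalCap L x u b) (hx : x ∈ interior L) (n : 𝔼) {η : ℝ} (hη : 0 < η)
    (hn : ∀ y ∈ L, ⟪u, y⟫ = b → ⟪n, y - x⟫ ≤ η) :
    ∀ y ∈ L, ⟪u, y⟫ = b → -((12 * 2 ^ d + 12) * η) ≤ ⟪n, y - x⟫ := by
  intro y₁ hy₁ hy₁b
  by_contra! hlt
  have hub := h.inner_eq hL hx
  obtain ⟨p, hp, hp1, -⟩ := exists_mem_interior_inner_lt h.1 hx one_pos
  have hpL := interior_subset hp
  set σ : ℝ := 2 ^ d with hσ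
  have hσ1 : 1 ≤ σ := one_le_pow₀ (by norm_num)
  set φp : ℝ := ⟪u, p⟫ - b with hφp
  have hφpos : 0 < φp := by rw [hφp]; linarith
  obtain ⟨M, hM⟩ : ∃ M : ℝ, ∀ y ∈ L, |⟪n, y - x⟫| ≤ M := by
    obtain ⟨M, hM⟩ := hL.exists_bound_of_continuousOn (f := fun y => (⟪n, y - x⟫ : ℝ))
      (by fun_prop)
    exact ⟨M, hM⟩
  have hM0 : 0 ≤ M := (abs_nonneg _).trans (hM y₁ hy₁)
  -- the rotation angle `θ` is so small that the relative height `t` of gained points is at most `τ`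
  obtain ⟨τ, hτ, hτ1, hτ2⟩ : ∃ τ : ℝ, 0 < τ ∧ τ * (4 * (σ + 1)) ≤ 1 ∧ τ * (σ * M) ≤ η := by
    refine ⟨min (1 / (4 * (σ + 1))) (η / (σ * (M + 1))), by positivity, ?_, ?_⟩
    · rw [← le_div_iff₀ (by positivity)]
      exact min_le_left _ _
    · calc _ ≤ η / (σ * (M + 1)) * (σ * (M + 1)) := by
            refine mul_le_mul (min_le_right _ _) ?_ (by positivity) (by positivity)
            gcongr
            linarith
        _ = η := by field_simp
  obtain ⟨θ, hθ, hθM⟩ : ∃ θ : ℝ, 0 < θ ∧ θ * M ≤ τ * φp := by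
    refine ⟨τ * φp / (M + 1), by positivity, ?_⟩
    rw [div_mul_eq_mul_div, div_le_iff₀ (by positivity)]
    gcongr
    linarith
  set C := cap L u b with hC
  set D := L ∩ {y | 0 ≤ ⟪u + θ • n, y - x⟫} with hD
  have hDiff : ∀ y : 𝔼, ⟪u + θ • n, y - x⟫ = ⟪u, y⟫ - b + θ * ⟪n, y - x⟫ := by
    intro y
    rw [inner_add_left, real_inner_smul_left, inner_sub_right u, hub]
  have hCm : MeasurableSet C := by
    refine hL.measurableSet.inter (IsClosed.measurableSet ?_)
    exact isClosed_le continuous_const (by fun_prop)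
  have hDm : MeasurableSet D :=
    hL.measurableSet.inter (isClosed_halfspace _ _ _).measurableSet
  have hCfin : volume C ≠ ⊤ := ((measure_mono inter_subset_left).trans_lt hL.measure_lt_top).ne
  have hle : volume (C \ D) ≤ volume (D \ C) := by
    have h1 := h.volume_le (u + θ • n)
    rw [← hC, ← hD, ← measure_inter_add_sdiff C hDm, ← measure_inter_add_sdiff D hCm,
      inter_comm D C] at h1
    exact (ENNReal.add_le_add_iff_left
      ((measure_mono inter_subset_left).trans_lt hCfin.lt_top).ne).1 h1
  -- the affine map from the gained wedge `D \ C` to the lost wedge `C \ D`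
  set f : 𝔼 := (-((σ + 1 / 2) / φp)) • (p - y₁) with hf
  set k : 𝔼 := (1 / 2 : ℝ) • y₁ - b • f with hk
  have huf : ⟪u, f⟫ = -(σ + 1 / 2) := by
    rw [hf, real_inner_smul_right, inner_sub_right, hy₁b, ← hφp]
    field_simp
  have hmaps : (fun y => rankOneMap (1 / 2) u f y + k) '' (D \ C) ⊆ C \ D := by
    rintro _ ⟨y, ⟨⟨hyL, hyD⟩, hyC⟩, rfl⟩
    have hy0 : ⟪u, y⟫ - b < 0 := by
      by_contra! hcon
      exact hyC ⟨hyL, by simpa using hcon⟩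
    have hyD' : 0 ≤ ⟪u, y⟫ - b + θ * ⟪n, y - x⟫ := by
      have : 0 ≤ ⟪u + θ • n, y - x⟫ := hyD
      rwa [hDiff] at this
    obtain ⟨t, ht⟩ : ∃ t : ℝ, t = (b - ⟪u, y⟫) / φp := ⟨_, rfl⟩
    have htφ : t * φp = b - ⟪u, y⟫ := by rw [ht]; field_simp
    have ht0 : 0 < t := by rw [ht]; exact div_pos (by linarith) hφpos
    have htτ : t ≤ τ := by
      refine le_of_mul_le_mul_right ?_ hφpos
      have := (le_abs_self _).trans (hM y hyL)
      nlinarith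
    -- `β` is the point of the base on the segment from `y` to `p`
    set β : 𝔼 := (1 / (1 + t)) • y + (t / (1 + t)) • p with hβ
    have h1t : (1 : ℝ) + t ≠ 0 := by positivity
    have hβL : β ∈ L := hconv hyL hpL (by positivity) (by positivity) (by field_simp)
    have hyβ : y = (1 + t) • β - t • p := by
      rw [hβ, smul_add, smul_smul, smul_smul, mul_one_div_cancel h1t, one_smul,
        mul_div_cancel₀ _ h1t]
      abel
    have hβb : ⟪u, β⟫ = b := by
      rw [hβ, inner_add_right, real_inner_smul_right, real_inner_smul_right]
      have : ⟪u, p⟫ = b + φp := by rw [hφp]; ring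
      rw [this]
      field_simp
      linarith
    have hF : rankOneMap (1 / 2) u f y + k =
        ((1 + t) / 2 - t * (1 + σ)) • y₁ + ((1 + t) / 2) • β + (t * σ) • p := by
      have e1 : rankOneMap (1 / 2) u f y + k =
          (1 / 2 : ℝ) • y + (1 / 2 : ℝ) • y₁ + (⟪u, y⟫ - b) • f := by
        rw [rankOneMap_apply, hk, sub_smul]; abel
      have e2 : (⟪u, y⟫ - b) • f = (t * (σ + 1 / 2)) • (p - y₁) := by
        rw [hf, smul_smul, ht]
        congr 1
        field_simp
        ring
      rw [e1, e2, hyβ]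
      module
    have hsum : ((1 + t) / 2 - t * (1 + σ)) + (1 + t) / 2 + t * σ = 1 := by ring
    have hw : 1 / 4 ≤ (1 + t) / 2 - t * (1 + σ) := by nlinarith
    have hFL : rankOneMap (1 / 2) u f y + k ∈ L := by
      rw [hF]
      exact convex_add_add_mem hconv hy₁ hβL hpL (by linarith) (by positivity) (by positivity) hsum
    have hψF : ⟪n, rankOneMap (1 / 2) u f y + k - x⟫ =
        ((1 + t) / 2 - t * (1 + σ)) * ⟪n, y₁ - x⟫ + ((1 + t) / 2) * ⟪n, β - x⟫ +
          (t * σ) * ⟪n, p - x⟫ := by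
      rw [hF]
      simp only [inner_sub_right, inner_add_right, real_inner_smul_right]
      ring
    have hψy : ⟪n, y - x⟫ = (1 + t) * ⟪n, β - x⟫ - t * ⟪n, p - x⟫ := by
      conv_lhs => rw [hyβ]
      simp only [inner_sub_right, real_inner_smul_right]
      ring
    have hφF : ⟪u, rankOneMap (1 / 2) u f y + k⟫ - b = σ * (b - ⟪u, y⟫) := by
      rw [hF]
      simp only [inner_add_right, real_inner_smul_right, hy₁b, hβb]
      have : ⟪u, p⟫ = b + φp := by rw [hφp]; ring
      rw [this, ← htφ]
      ring
    have hβη := hn β hβL hβb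
    have hpM := abs_le.1 (hM p hpL)
    have htσM : t * (σ * M) ≤ η := (mul_le_mul_of_nonneg_right htτ (by positivity)).trans hτ2
    have ht1 : t ≤ 1 := by nlinarith
    have hψy3 : ⟪n, y - x⟫ ≤ 3 * η := by
      rw [hψy]
      have : t * M ≤ t * (σ * M) := by
        gcongr
        exact le_mul_of_one_le_left hM0 hσ1
      nlinarith
    have hψF3 : ⟪n, rankOneMap (1 / 2) u f y + k - x⟫ < -(3 * σ * η) := by
      rw [hψF]
      have e1 : ((1 + t) / 2 - t * (1 + σ)) * ⟪n, y₁ - x⟫ < -((3 * σ + 3) * η) := by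
        have hneg : ⟪n, y₁ - x⟫ ≤ 0 := hlt.le.trans (by
          have : 0 ≤ (12 * σ + 12) * η := by positivity
          linarith)
        have := mul_le_mul_of_nonpos_right hw hneg
        linarith
      have e2 : ((1 + t) / 2) * ⟪n, β - x⟫ ≤ η := by nlinarith
      have e3 : (t * σ) * ⟪n, p - x⟫ ≤ η := by
        refine le_trans ?_ htσM
        rw [← mul_assoc]
        gcongr
        exact hpM.2
      linarith
    refine ⟨⟨hFL, ?_⟩, fun hcon => ?_⟩
    · have : 0 ≤ ⟪u, rankOneMap (1 / 2) u f y + k⟫ - b := by rw [hφF]; nlinarith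
      simpa using this
    · have h0 : 0 ≤ ⟪u + θ • n, rankOneMap (1 / 2) u f y + k - x⟫ := hcon.2
      rw [hDiff, hφF] at h0
      have e1 : σ * (b - ⟪u, y⟫) ≤ σ * (θ * (3 * η)) := by
        gcongr
        nlinarith
      nlinarith
  have hdouble : 2 * volume (D \ C) ≤ volume (C \ D) := by
    refine le_trans (le_of_eq ?_) (measure_mono hmaps)
    rw [volume_image_rankOneMap_add (by norm_num), huf]
    congr 1
    have : |(1 / 2 : ℝ) ^ d * (1 + -(σ + 1 / 2) / (1 / 2))| = 2 := by
      have e : (1 / 2 : ℝ) ^ d * (1 + -(σ + 1 / 2) / (1 / 2)) = -2 := by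
        rw [hσ, one_div, inv_pow]
        field_simp
        ring
      rw [e]; norm_num
    rw [this]
    simp
  have hpos : 0 < volume (C \ D) := by
    have hsub : interior L ∩ {y | b < ⟪u, y⟫ ∧ ⟪u + θ • n, y - x⟫ < 0} ⊆ C \ D := by
      rintro y ⟨hy1, hy2, hy3⟩
      exact ⟨⟨interior_subset hy1, hy2.le⟩, fun hcon => (lt_irrefl (0 : ℝ) (hcon.2.trans_lt hy3))⟩
    refine lt_of_lt_of_le (IsOpen.measure_pos _ ?_ ?_) (measure_mono hsub)
    · refine isOpen_interior.inter (IsOpen.inter ?_ ?_)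
      · exact isOpen_Ioi.preimage (innerSL ℝ u).continuous
      · exact isOpen_Iio.preimage
          ((innerSL ℝ (u + θ • n)).continuous.comp (continuous_id.sub continuous_const))
    · have hcont : Continuous fun s : ℝ => (⟪u + θ • n, y₁ + s • (p - y₁) - x⟫ : ℝ) := by fun_prop
      have h1 : ∀ᶠ s in nhds (0 : ℝ), ⟪u + θ • n, y₁ + s • (p - y₁) - x⟫ < 0 := by
        refine hcont.continuousAt.eventually_lt continuousAt_const ?_
        simp only [zero_smul, add_zero]
        rw [hDiff, hy₁b]
        have : ⟪n, y₁ - x⟫ < 0 := hlt.trans_le (by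
          have : 0 ≤ (12 * σ + 12) * η := by positivity
          linarith)
        nlinarith
      have h2 : ∀ᶠ s in nhds (0 : ℝ), s < 1 := eventually_lt_nhds one_pos
      obtain ⟨s, ⟨h1, h2⟩, h3⟩ := (((h1.and h2).filter_mono nhdsWithin_le_nhds).and
        (self_mem_nhdsWithin (a := (0 : ℝ)) (s := Ioi 0))).exists
      have h3 : 0 < s := h3
      refine ⟨y₁ + s • (p - y₁), ?_, ?_, h1⟩
      · exact hconv.add_smul_sub_mem_interior hy₁ hp ⟨h3, h2.le⟩
      · have : ⟪u, y₁ + s • (p - y₁)⟫ = b + s * φp := by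
          rw [inner_add_right, real_inner_smul_right, inner_sub_right, hy₁b]
        show b < ⟪u, y₁ + s • (p - y₁)⟫
        rw [this]
        linarith [mul_pos h3 hφpos]
  have hfin : volume (C \ D) ≠ ⊤ := ((measure_mono sdiff_subset).trans_lt hCfin.lt_top).ne
  have : volume (C \ D) < volume (C \ D) := by
    calc volume (C \ D) < 2 * volume (C \ D) := by
          rw [two_mul]; exact ENNReal.lt_add_right hfin hpos.ne'
      _ ≤ 2 * volume (D \ C) := by gcongr
      _ ≤ volume (C \ D) := hdouble
  exact lt_irrefl _ this

/-! ### Caps compared with prisms -/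

/-- The prism of height `2` with cross-section `T` and axis direction `v`. -/
def prism (T : Set 𝔼) (v : 𝔼) : Set 𝔼 :=
  {y | ∃ q ∈ T, ∃ τ : ℝ, |τ| ≤ 1 ∧ y = q + τ • v}

/-- A cap lies in the cone with apex `e` over its base; this cone, truncated to the width of the
cap, is contained in an affine image of a prism over the base. -/
lemma volume_cap_le_prism {A T : Set 𝔼} (hA : Convex ℝ A) {m v e w : 𝔼} {t ω α R : ℝ}
    (hmv : ⟪m, v⟫ = 1) (hT : ∀ q ∈ T, ⟪m, q⟫ = 0)
    (hstar : ∀ q ∈ T, ∀ s : ℝ, 0 ≤ s → s ≤ 1 → s • q ∈ T) (hω : 0 < ω) (hα : 0 < α) (hR : 0 < R)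
    (he : e ∈ A) (het : ⟪m, e⟫ < t) (hw : ⟪m, w⟫ = t)
    (hbase : ∀ y ∈ A, ⟪m, y⟫ = t → ∃ q ∈ T, y = w + α • q)
    (htop : ∀ y ∈ A, ⟪m, y⟫ ≤ t + ω) (hratio : t + ω - ⟪m, e⟫ ≤ R * (t - ⟪m, e⟫)) :
    volume (A ∩ {y | t ≤ ⟪m, y⟫}) ≤
      ENNReal.ofReal ((R * α) ^ d * (ω / (R * α))) * volume (prism T v) := by
  set l : ℝ := t - ⟪m, e⟫ with hl
  have hl0 : 0 < l := by rw [hl]; linarith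
  set f : 𝔼 := (1 / l) • (w - e) with hf
  have hmf : ⟪m, f⟫ = 1 := by
    rw [hf, real_inner_smul_right, inner_sub_right, hw, ← hl]
    field_simp
  have hRα : R * α ≠ 0 := by positivity
  have hsub : A ∩ {y | t ≤ ⟪m, y⟫} ⊆
      (fun y => rankOneMap (R * α) m (ω • f - (R * α) • v) y + w) '' prism T v := by
    rintro y ⟨hyA, hyt⟩
    have hyt : t ≤ ⟪m, y⟫ := hyt
    have hytop := htop y hyA
    obtain ⟨ν, hν⟩ : ∃ ν : ℝ, ν = 1 + (⟪m, y⟫ - t) / l := ⟨_, rfl⟩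
    have hν1 : 1 ≤ ν := by
      rw [hν]
      have : 0 ≤ (⟪m, y⟫ - t) / l := div_nonneg (by linarith) hl0.le
      linarith
    have hν0 : 0 < ν := by linarith
    have hνl : ν * l = ⟪m, y⟫ - ⟪m, e⟫ := by rw [hν, hl]; rw [hl] at hl0; field_simp; ring
    have hνR : ν ≤ R := by
      refine le_of_mul_le_mul_right ?_ hl0
      linarith
    have hy₀ : e + (1 / ν) • (y - e) ∈ A :=
      hA.add_smul_sub_mem he hyA ⟨by positivity, by rw [div_le_one hν0]; exact hν1⟩
    obtain ⟨q, hq, hyq⟩ := hbase _ hy₀ (by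
      rw [inner_add_right, real_inner_smul_right, inner_sub_right, ← hνl]
      field_simp
      rw [hl]; ring)
    have hy : y = w + (ν * α) • q + (ν - 1) • (w - e) := by
      have h1 : y - e = ν • (w + α • q - e) := by
        rw [← hyq, add_sub_cancel_left, smul_smul, mul_one_div_cancel hν0.ne', one_smul]
      rw [← sub_add_cancel y e, h1]
      module
    refine ⟨(ν / R) • q + ((⟪m, y⟫ - t) / ω) • v, ⟨_, hstar q hq _ (by positivity)
      (by rwa [div_le_one hR]), _, ?_, rfl⟩, ?_⟩
    · rw [abs_of_nonneg (div_nonneg (by linarith) hω.le), div_le_one hω]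
      linarith
    · have h1 : ⟪m, (ν / R) • q + ((⟪m, y⟫ - t) / ω) • v⟫ = (⟪m, y⟫ - t) / ω := by
        rw [inner_add_right, real_inner_smul_right, real_inner_smul_right, hT q hq, hmv]
        ring
      have h2 : ((⟪m, y⟫ - t) / ω) • ω • f = (ν - 1) • (w - e) := by
        rw [hf, smul_smul, smul_smul, hν]
        congr 1
        field_simp
        ring
      have h3 : (R * α) • (ν / R) • q = (ν * α) • q := by
        rw [smul_smul]
        congr 1
        field_simp
      simp only
      rw [rankOneMap_apply, h1, smul_sub, h2, smul_add, h3]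
      conv_rhs => rw [hy]
      module
  refine (measure_mono hsub).trans (le_of_eq ?_)
  rw [volume_image_rankOneMap_add hRα]
  congr 2
  have h1 : ⟪m, ω • f - (R * α) • v⟫ = ω - R * α := by
    rw [inner_sub_right, real_inner_smul_right m f, real_inner_smul_right m v, hmf, hmv]; ring
  rw [h1, show 1 + (ω - R * α) / (R * α) = ω / (R * α) by field_simp; ring]
  exact abs_of_pos (by positivity)

/-- A cap contains the convex hull of its base and a highest point, hence an affine image of a
prism over the base. -/
lemma prism_le_volume_cap {A T : Set 𝔼} (hA : Convex ℝ A) {m v p w : 𝔼} {t ω α : ℝ}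
    (hmv : ⟪m, v⟫ = 1) (hT : ∀ q ∈ T, ⟪m, q⟫ = 0)
    (hstar : ∀ q ∈ T, ∀ s : ℝ, 0 ≤ s → s ≤ 1 → s • q ∈ T) (hω : 0 < ω) (hα : 0 < α)
    (hp : p ∈ A) (hpt : ⟪m, p⟫ = t + ω) (hw : ⟪m, w⟫ = t)
    (hbase : ∀ q ∈ T, w + α • q ∈ A) :
    ENNReal.ofReal ((α / 2) ^ d * (ω / 4 / (α / 2))) * volume (prism T v) ≤
      volume (A ∩ {y | t ≤ ⟪m, y⟫}) := by
  set f : 𝔼 := (1 / ω) • (p - w) with hf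
  have hmf : ⟪m, f⟫ = 1 := by
    rw [hf, real_inner_smul_right, inner_sub_right, hw, hpt]
    field_simp
    ring
  have hsub : (fun y => rankOneMap (α / 2) m ((ω / 4) • f - (α / 2) • v) y + (w + (ω / 4) • f)) ''
      prism T v ⊆ A ∩ {y | t ≤ ⟪m, y⟫} := by
    rintro _ ⟨_, ⟨q, hq, τ, hτ, rfl⟩, rfl⟩
    obtain ⟨hτ1, hτ2⟩ := abs_le.1 hτ
    have h1 : ⟪m, q + τ • v⟫ = τ := by
      rw [inner_add_right, real_inner_smul_right, hT q hq, hmv]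
      ring
    obtain ⟨l, hl⟩ : ∃ l : ℝ, l = (τ + 1) / 4 := ⟨_, rfl⟩
    have hl0 : 0 ≤ l := by rw [hl]; linarith
    have hl1 : l ≤ 1 / 2 := by rw [hl]; linarith
    have hl2 : 0 < 1 - l := by linarith
    have hq' : w + α • ((1 / (2 * (1 - l))) • q) ∈ A := by
      refine hbase _ (hstar q hq _ (by positivity) ?_)
      rw [div_le_one (by positivity)]
      linarith
    have h2 : rankOneMap (α / 2) m ((ω / 4) • f - (α / 2) • v) (q + τ • v) + (w + (ω / 4) • f) =
        (1 - l) • (w + α • ((1 / (2 * (1 - l))) • q)) + l • p := by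
      have h3 : (1 - l) • α • (1 / (2 * (1 - l))) • q = (α / 2) • q := by
        rw [smul_smul, smul_smul]
        congr 1
        field_simp
      have h4 : (ω / 4) • f = (1 / 4 : ℝ) • (p - w) := by
        rw [hf, smul_smul]
        congr 1
        field_simp
      rw [rankOneMap_apply, h1, smul_add (1 - l), h3, h4, hl]
      module
    simp only
    rw [h2]
    refine ⟨hA hq' hp hl2.le hl0 (by ring), ?_⟩
    have h5 : ⟪m, (1 - l) • (w + α • ((1 / (2 * (1 - l))) • q)) + l • p⟫ = t + l * ω := by
      simp only [inner_add_right, real_inner_smul_right, hT q hq, hw, hpt]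
      ring
    show t ≤ _
    rw [h5]
    linarith [mul_nonneg hl0 hω.le]
  refine le_trans (le_of_eq ?_) (measure_mono hsub)
  rw [volume_image_rankOneMap_add (by positivity)]
  congr 2
  have h1 : ⟪m, (ω / 4) • f - (α / 2) • v⟫ = ω / 4 - α / 2 := by
    rw [inner_sub_right, real_inner_smul_right m f, real_inner_smul_right m v, hmf, hmv]; ring
  rw [h1, show 1 + (ω / 4 - α / 2) / (α / 2) = ω / 4 / (α / 2) by field_simp; ring]
  exact (abs_of_pos (by positivity)).symm

lemma convex_prism {T : Set 𝔼} (hT : Convex ℝ T) (v : 𝔼) : Convex ℝ (prism T v) := by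
  rintro _ ⟨q, hq, τ, hτ, rfl⟩ _ ⟨q', hq', τ', hτ', rfl⟩ α β hα hβ hαβ
  refine ⟨α • q + β • q', hT hq hq' hα hβ hαβ, α * τ + β * τ', ?_, by module⟩
  have h1 := abs_le.1 hτ
  have h2 := abs_le.1 hτ'
  rw [abs_le]
  constructor <;> nlinarith

/-! ### Polar bodies -/

lemma isClosed_polar (K : Set 𝔼) : IsClosed (polar K) := by
  have h : polar K = ⋂ p ∈ K, {y : 𝔼 | ⟪y, p⟫ ≤ 1} := by ext; simp [polar]
  rw [h]
  exact isClosed_biInter fun p _ => isClosed_le (by fun_prop) continuous_const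

lemma convex_polar (K : Set 𝔼) : Convex ℝ (polar K) := by
  intro y hy z hz a b ha hb hab p hp
  rw [inner_add_left, real_inner_smul_left, real_inner_smul_left]
  calc a * ⟪y, p⟫ + b * ⟪z, p⟫ ≤ a * 1 + b * 1 := by
        gcongr
        · exact hy p hp
        · exact hz p hp
    _ = 1 := by rw [mul_one, mul_one, hab]

lemma convex_capBase (K : Set 𝔼) (u : 𝔼) (b : ℝ) : Convex ℝ (capBase (polar K) u b) := by
  refine Convex.inter ?_ (convex_polar K)
  intro y hy z hz α β _ _ hαβ
  have hy : ⟪u, y⟫ = b := hy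
  have hz : ⟪u, z⟫ = b := hz
  show ⟪u, α • y + β • z⟫ = b
  rw [inner_add_right, real_inner_smul_right, real_inner_smul_right, hy, hz, ← add_mul, hαβ,
    one_mul]

lemma closedBall_subset_polar {K : Set 𝔼} {ρ : ℝ} (hρ : 0 < ρ) (hK : K ⊆ closedBall 0 (1 / ρ)) :
    closedBall 0 ρ ⊆ polar K := by
  intro y hy p hp
  have hy : ‖y‖ ≤ ρ := by simpa using hy
  have hp : ‖p‖ ≤ 1 / ρ := by simpa using hK hp
  calc ⟪y, p⟫ ≤ ‖y‖ * ‖p‖ := real_inner_le_norm _ _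
    _ ≤ ρ * (1 / ρ) := by gcongr
    _ = 1 := by field_simp

lemma polar_subset_closedBall {K : Set 𝔼} {ρ : ℝ} (hρ : 0 < ρ) (hK : closedBall 0 ρ ⊆ K) :
    polar K ⊆ closedBall 0 (1 / ρ) := by
  intro y hy
  rw [mem_closedBall_zero_iff]
  rcases eq_or_ne y 0 with rfl | hy0
  · simp [hρ.le]
  have hn : 0 < ‖y‖ := norm_pos_iff.2 hy0
  have h := hy ((ρ / ‖y‖) • y) (hK (by
    rw [mem_closedBall_zero_iff, norm_smul, Real.norm_of_nonneg (by positivity)]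
    field_simp
    exact le_refl _))
  rw [real_inner_smul_right, real_inner_self_eq_norm_sq] at h
  rw [le_div_iff₀ hρ]
  calc ‖y‖ * ρ = ρ / ‖y‖ * ‖y‖ ^ 2 := by field_simp
    _ ≤ 1 := h

lemma isCompact_polar {K : Set 𝔼} {ρ : ℝ} (hρ : 0 < ρ) (hK : closedBall 0 ρ ⊆ K) :
    IsCompact (polar K) :=
  (isCompact_closedBall 0 (1 / ρ)).of_isClosed_subset (isClosed_polar K)
    (polar_subset_closedBall hρ hK)

/-- The nontrivial inclusion of the bipolar theorem. -/
lemma mem_of_forall_mem_polar {K : Set 𝔼} (hconv : Convex ℝ K) (hcl : IsClosed K) (h0 : 0 ∈ K)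
    {p : 𝔼} (h : ∀ y ∈ polar K, ⟪y, p⟫ ≤ 1) : p ∈ K := by
  by_contra hp
  obtain ⟨f, s, hf1, hf2⟩ := geometric_hahn_banach_closed_point hconv hcl hp
  obtain ⟨y, rfl⟩ := (InnerProductSpace.toDual ℝ 𝔼).surjective f
  simp only [InnerProductSpace.toDual_apply_apply] at hf1 hf2
  have hs : 0 < s := by simpa using hf1 0 h0
  have h1 := h ((1 / s) • y) (fun q hq => by
    rw [real_inner_smul_left, one_div_mul_eq_div, div_le_one hs]
    exact (hf1 q hq).le)
  rw [real_inner_smul_left, one_div_mul_eq_div, div_le_one hs] at h1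
  linarith

/-! ### Minimum volume caps close to the boundary are thin -/

/-- The data of a cap of `K` seen from the polar body: `K` lies between the balls of radius `ρ` and
`1 / ρ`, and `H` is the maximal height of `K` above the origin in the vertical direction `v`,
attained at `m`. In `polar K` the point `v / H` is the upper end of the vertical axis, and
`{p | ⟪m, p⟫ = 1}` supports `polar K` there. -/
structure IsSupported (ρ : ℝ) (K : Set (EuclideanSpace ℝ (Fin d)))
    (v m : EuclideanSpace ℝ (Fin d)) (H : ℝ) : Prop where
  pos : 0 < ρ
  convex : Convex ℝ K
  isClosed : IsClosed K
  ball_subset : closedBall 0 ρ ⊆ K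
  subset_ball : K ⊆ closedBall 0 (1 / ρ)
  norm_eq : ‖v‖ = 1
  mem : m ∈ K
  inner_eq : ⟪v, m⟫ = H
  inner_le : ∀ p ∈ K, ⟪v, p⟫ ≤ H

namespace IsSupported

variable {ρ H : ℝ} {K : Set (EuclideanSpace ℝ (Fin d))} {v m : EuclideanSpace ℝ (Fin d)}

lemma le_height (h : IsSupported ρ K v m H) : ρ ≤ H := by
  have h1 := h.inner_le (ρ • v) (h.ball_subset (by
    rw [mem_closedBall_zero_iff, norm_smul, h.norm_eq, Real.norm_of_nonneg h.pos.le, mul_one]))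
  rwa [real_inner_smul_right, real_inner_self_eq_norm_sq, h.norm_eq, one_pow, mul_one] at h1

lemma height_pos (h : IsSupported ρ K v m H) : 0 < H := h.pos.trans_le h.le_height

lemma norm_normal_le (h : IsSupported ρ K v m H) : ‖m‖ ≤ 1 / ρ := by
  simpa using h.subset_ball h.mem

lemma height_le_norm (h : IsSupported ρ K v m H) : H ≤ ‖m‖ := by
  have := real_inner_le_norm v m
  rwa [h.inner_eq, h.norm_eq, one_mul] at this

lemma height_le (h : IsSupported ρ K v m H) : H ≤ 1 / ρ := h.height_le_norm.trans h.norm_normal_le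

lemma normal_inner_axis (h : IsSupported ρ K v m H) (s : ℝ) : ⟪m, s • v⟫ = s * H := by
  rw [real_inner_smul_right, real_inner_comm, h.inner_eq]

lemma normal_inner_le (h : IsSupported ρ K v m H) {y : 𝔼} (hy : y ∈ polar K) : ⟪m, y⟫ ≤ 1 := by
  rw [real_inner_comm]; exact hy m h.mem

lemma axis_mem (h : IsSupported ρ K v m H) {s : ℝ} (hs : 0 ≤ s) (hsH : s * H ≤ 1) :
    s • v ∈ polar K := by
  intro p hp
  rw [real_inner_smul_left]
  exact (mul_le_mul_of_nonneg_left (h.inner_le p hp) hs).trans hsH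

lemma top_mem_frontier (h : IsSupported ρ K v m H) : (1 / H) • v ∈ frontier (polar K) := by
  have hH := h.height_pos
  rw [(isClosed_polar K).frontier_eq]
  refine ⟨h.axis_mem (by positivity) (by field_simp; exact le_refl _), fun hint => ?_⟩
  have hm : 0 < ‖m‖ := hH.trans_le h.height_le_norm
  obtain ⟨p, hp, hp1, -⟩ := exists_mem_interior_inner_lt (u := ‖m‖⁻¹ • m)
    (by rw [norm_smul, norm_inv, norm_norm, inv_mul_cancel₀ hm.ne']) hint one_pos
  rw [real_inner_smul_left, real_inner_smul_left] at hp1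
  have h1 := lt_of_mul_lt_mul_left hp1 (inv_pos.2 hm).le
  rw [h.normal_inner_axis, one_div_mul_cancel hH.ne'] at h1
  linarith [h.normal_inner_le (interior_subset hp)]

/-- The distance of a point on the vertical axis to the boundary of the polar body is, up to
constants, the distance to the upper end of the axis. -/
lemma gap_bounds (h : IsSupported ρ K v m H) {s : ℝ} (hs : 0 ≤ s) (hx : s • v ∈ polar K) :
    ρ * infDist (s • v) (frontier (polar K)) ≤ 1 - s * H ∧
      ρ * (1 - s * H) ≤ infDist (s • v) (frontier (polar K)) := by
  have hH := h.height_pos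
  have hsH : s * H ≤ 1 := by
    have := h.normal_inner_le hx
    rwa [h.normal_inner_axis] at this
  constructor
  · have h1 : infDist (s • v) (frontier (polar K)) ≤ (1 - s * H) / H := by
      refine (infDist_le_dist_of_mem h.top_mem_frontier).trans (le_of_eq ?_)
      rw [dist_comm, dist_eq_norm, ← sub_smul, norm_smul, h.norm_eq, mul_one, Real.norm_eq_abs,
        show 1 / H - s = (1 - s * H) / H by field_simp, abs_of_nonneg]
      exact div_nonneg (by linarith) hH.le
    rw [le_div_iff₀ hH] at h1
    have := mul_le_mul_of_nonneg_left h.le_height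
      (infDist_nonneg (x := s • v) (s := frontier (polar K)))
    linarith
  · by_contra! hlt
    obtain ⟨y, hy, hdist⟩ := (infDist_lt_iff ⟨_, h.top_mem_frontier⟩).1 hlt
    have hball : ball (s • v) (ρ * (1 - s * H)) ⊆ polar K := by
      intro z hz p hp
      have h1 : ‖z - s • v‖ < ρ * (1 - s * H) := by simpa [dist_eq_norm] using hz
      have h2 : ‖p‖ ≤ 1 / ρ := by simpa using h.subset_ball hp
      have h3 : ⟪z - s • v, p⟫ ≤ 1 - s * H := by
        calc ⟪z - s • v, p⟫ ≤ ‖z - s • v‖ * ‖p‖ := real_inner_le_norm _ _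
          _ ≤ (ρ * (1 - s * H)) * (1 / ρ) := by
              gcongr
              exact mul_nonneg h.pos.le (by linarith)
          _ = 1 - s * H := by field_simp [h.pos.ne']
      have h4 : s * ⟪v, p⟫ ≤ s * H := mul_le_mul_of_nonneg_left (h.inner_le p hp) hs
      rw [inner_sub_left, real_inner_smul_left] at h3
      linarith
    have hyint : y ∈ interior (polar K) :=
      interior_maximal hball isOpen_ball (by rwa [mem_ball, dist_comm])
    exact hy.2 hyint

lemma mem_interior (h : IsSupported ρ K v m H) {s : ℝ} (hs : 0 ≤ s) (hx : s • v ∈ polar K)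
    (hη : 0 < 1 - s * H) : s • v ∈ interior (polar K) := by
  by_contra hcon
  have hfr : s • v ∈ frontier (polar K) := by
    rw [(isClosed_polar K).frontier_eq]; exact ⟨hx, hcon⟩
  have h1 := (h.gap_bounds hs hx).2
  rw [infDist_zero_of_mem hfr] at h1
  linarith [mul_pos h.pos hη]

/-- A minimum volume cap containing a point close to the boundary does not contain the origin:
otherwise it would contain a ball of radius `ρ / 2`, while the cap with normal `m` through the
point has small volume, as stretching it by the factor `1 / η` leaves it in a ball. -/
lemma base_height_pos (h : IsSupported ρ K v m H) {x u : 𝔼} {b η : ℝ}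
    (hmin : IsMinimalCap (polar K) x u b) (hη : 0 < η) (hη1 : η ≤ 1) (hx : ⟪m, x⟫ = 1 - η)
    (hsmall : η * (6 / ρ ^ 2) ^ d < 1) : 0 < b := by
  by_contra! hb
  have hρ := h.pos
  have hm : 0 < ‖m‖ := h.height_pos.trans_le h.height_le_norm
  have hLb := polar_subset_closedBall hρ h.ball_subset
  set S := polar K ∩ {y | 0 ≤ ⟪m, y - x⟫} with hS
  set f : 𝔼 := ((1 / η - 1) / ‖m‖ ^ 2) • m with hf
  have hsub : (fun y => rankOneMap 1 m f y + -rankOneMap 1 m f x) '' S ⊆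
      closedBall 0 (3 / ρ) := by
    rintro _ ⟨y, ⟨hyL, hy0⟩, rfl⟩
    have hy0 : 0 ≤ ⟪m, y - x⟫ := hy0
    have hy1 : ⟪m, y - x⟫ ≤ η := by
      rw [inner_sub_right, hx]
      linarith [h.normal_inner_le hyL]
    have e : rankOneMap 1 m f y + -rankOneMap 1 m f x = (y - x) + ⟪m, y - x⟫ • f := by
      rw [← sub_eq_add_neg, ← map_sub, rankOneMap_apply, one_smul]
    have hny : ‖y‖ ≤ 1 / ρ := by simpa using hLb hyL
    have hnx : ‖x‖ ≤ 1 / ρ := by simpa using hLb hmin.2.1.1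
    have h1η : 0 ≤ 1 / η - 1 := by
      rw [sub_nonneg, one_le_div hη]; exact hη1
    have hnf : ‖⟪m, y - x⟫ • f‖ ≤ 1 / ρ := by
      rw [norm_smul, hf, norm_smul, Real.norm_of_nonneg hy0, Real.norm_of_nonneg (by positivity)]
      calc ⟪m, y - x⟫ * ((1 / η - 1) / ‖m‖ ^ 2 * ‖m‖)
          ≤ η * ((1 / η - 1) / ‖m‖ ^ 2 * ‖m‖) := by gcongr
        _ = (1 - η) / ‖m‖ := by field_simp
        _ ≤ 1 / ρ := by
          gcongr
          · linarith
          · exact h.le_height.trans h.height_le_norm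
    rw [mem_closedBall_zero_iff]
    beta_reduce
    rw [e]
    calc _ ≤ ‖y - x‖ + ‖⟪m, y - x⟫ • f‖ := norm_add_le _ _
      _ ≤ (‖y‖ + ‖x‖) + 1 / ρ := add_le_add (norm_sub_le _ _) hnf
      _ ≤ (1 / ρ + 1 / ρ) + 1 / ρ := by gcongr
      _ = 3 / ρ := by ring
  have hball : closedBall ((ρ / 2) • u) (ρ / 2) ⊆ cap (polar K) u b := by
    intro y hy
    have hy : ‖y - (ρ / 2) • u‖ ≤ ρ / 2 := by simpa [dist_eq_norm] using hy
    refine ⟨closedBall_subset_polar hρ h.subset_ball ?_, ?_⟩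
    · rw [mem_closedBall_zero_iff]
      calc ‖y‖ = ‖(y - (ρ / 2) • u) + (ρ / 2) • u‖ := by rw [sub_add_cancel]
        _ ≤ ‖y - (ρ / 2) • u‖ + ‖(ρ / 2) • u‖ := norm_add_le _ _
        _ ≤ ρ / 2 + ρ / 2 := by
          gcongr
          rw [norm_smul, hmin.1, Real.norm_of_nonneg (by positivity), mul_one]
        _ = ρ := by ring
    · have h1 := neg_le_of_abs_le (abs_real_inner_le_norm u (y - (ρ / 2) • u))
      rw [hmin.1, one_mul, inner_sub_right, real_inner_smul_right, real_inner_self_eq_norm_sq,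
        hmin.1] at h1
      show b ≤ ⟪u, y⟫
      linarith
  have hdet : |(1 : ℝ) ^ d * (1 + ⟪m, f⟫ / 1)| = 1 / η := by
    rw [hf, real_inner_smul_right, real_inner_self_eq_norm_sq]
    have : (1 / η - 1) / ‖m‖ ^ 2 * ‖m‖ ^ 2 = 1 / η - 1 := by field_simp
    rw [this, one_pow, one_mul, div_one, add_sub_cancel]
    exact abs_of_pos (by positivity)
  have h1 := measure_mono (μ := volume) hsub
  rw [volume_image_rankOneMap_add one_ne_zero, hdet] at h1
  have h2 := ((measure_mono (μ := volume) hball).trans (hmin.volume_le m))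
  have h3 : ENNReal.ofReal (1 / η) * volume (closedBall ((ρ / 2) • u) (ρ / 2)) ≤
      volume (closedBall (0 : 𝔼) (3 / ρ)) := le_trans (by gcongr) h1
  rw [Measure.addHaar_closedBall _ _ (by positivity), Measure.addHaar_closedBall _ _ (by positivity),
    ← mul_assoc, ENNReal.mul_le_mul_iff_left (measure_ball_pos _ _ one_pos).ne'
      measure_ball_lt_top.ne, ← ENNReal.ofReal_mul (by positivity),
    ENNReal.ofReal_le_ofReal_iff (by positivity), finrank_euclideanSpace, Fintype.card_fin] at h3
  have h4 : (ρ / 2) ^ d * (6 / ρ ^ 2) ^ d = (3 / ρ) ^ d := by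
    rw [← mul_pow]
    congr 1
    field_simp
    norm_num
  rw [← h4, one_div_mul_eq_div, div_le_iff₀ hη] at h3
  have h5 : (ρ / 2) ^ d * 1 ≤ (ρ / 2) ^ d * (η * (6 / ρ ^ 2) ^ d) := by linarith
  exact (le_of_mul_le_mul_left h5 (by positivity)).not_gt hsmall

end IsSupported

/-- The constant in the balance property of minimum volume caps. -/
noncomputable def balanceConst (d : ℕ) : ℝ := 12 * 2 ^ d + 12

lemma balanceConst_pos (d : ℕ) : 0 < balanceConst d := by unfold balanceConst; positivity

/-- A cap of `polar K` with normal `u` and base through the point `s • v` at height `b` over the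
origin that is balanced about this point and whose width is, relative to `b`, at most a constant
times `η`, the depth of `s • v`. -/
structure IsThinCap (ρ : ℝ) (K : Set (EuclideanSpace ℝ (Fin d)))
    (v m : EuclideanSpace ℝ (Fin d)) (H s η : ℝ) (u : EuclideanSpace ℝ (Fin d)) (b : ℝ) : Prop
    extends IsSupported ρ K v m H where
  depth_eq : η = 1 - s * H
  depth_pos : 0 < η
  depth_le : (balanceConst d + 1) * η ≤ 1 / 2
  height_nonneg : 0 ≤ s
  mem_interior_polar : s • v ∈ interior (polar K)
  base_pos : 0 < b
  inner_axis : s * ⟪u, v⟫ = b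
  norm_normal : ‖u‖ = 1
  width_le : ∀ y ∈ polar K, ⟪u, y⟫ * (1 - (balanceConst d + 1) * η) ≤ b
  balanced : ∀ (n : EuclideanSpace ℝ (Fin d)) (t : ℝ), 0 < t →
    (∀ y ∈ polar K, ⟪u, y⟫ = b → ⟪n, y - s • v⟫ ≤ t) →
    ∀ y ∈ polar K, ⟪u, y⟫ = b → -(balanceConst d * t) ≤ ⟪n, y - s • v⟫

/-- The central projection from the origin moves a highest point of the cap to a base point. By
balance in direction `m`, this base point is still close to the supporting hyperplane with normal
`m`, which bounds the ratio of the two heights. -/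
lemma IsMinimalCap.isThinCap {ρ H s η b : ℝ} {K : Set (EuclideanSpace ℝ (Fin d))}
    {v m u : EuclideanSpace ℝ (Fin d)} (h : IsSupported ρ K v m H)
    (hmin : IsMinimalCap (polar K) (s • v) u b) (hs : 0 ≤ s) (hηdef : η = 1 - s * H) (hη : 0 < η)
    (hη2 : (balanceConst d + 1) * η ≤ 1 / 2) (hsmall : η * (6 / ρ ^ 2) ^ d < 1) :
    IsThinCap ρ K v m H s η u b := by
  have hL := isCompact_polar h.pos h.ball_subset
  have hint := h.mem_interior hs hmin.2.1.1 (hηdef ▸ hη)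
  have hub := hmin.inner_eq hL hint
  have hκ := balanceConst_pos d
  have hb : 0 < b := h.base_height_pos hmin hη (by nlinarith)
    (by rw [h.normal_inner_axis, hηdef]; ring) hsmall
  have hbal : ∀ (n : 𝔼) (t : ℝ), 0 < t → (∀ y ∈ polar K, ⟪u, y⟫ = b → ⟪n, y - s • v⟫ ≤ t) →
      ∀ y ∈ polar K, ⟪u, y⟫ = b → -(balanceConst d * t) ≤ ⟪n, y - s • v⟫ :=
    fun n t ht hn => hmin.balanced hL (convex_polar K) hint n ht hn
  refine ⟨h, hηdef, hη, hη2, hs, hint, hb, ?_, hmin.1, fun y hy => ?_, hbal⟩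
  · rw [← hub, real_inner_smul_right]
  rcases le_or_gt ⟪u, y⟫ b with hyb | hyb
  · nlinarith [mul_pos (show 0 < balanceConst d + 1 by linarith) hη]
  have hy0 : 0 < ⟪u, y⟫ := hb.trans hyb
  have h0 : (0 : 𝔼) ∈ polar K := closedBall_subset_polar h.pos h.subset_ball (by simp [h.pos.le])
  have hy₀ : (b / ⟪u, y⟫) • y ∈ polar K :=
    (convex_polar K).smul_mem_of_zero_mem h0 hy ⟨by positivity, by rw [div_le_one hy0]; exact hyb.le⟩
  have h1 := hbal m η hη (fun z hz _ => by
    rw [inner_sub_right, h.normal_inner_axis]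
    linarith [h.normal_inner_le hz]) _ hy₀ (by rw [real_inner_smul_right]; field_simp)
  rw [inner_sub_right, h.normal_inner_axis, real_inner_smul_right] at h1
  have h2 : b / ⟪u, y⟫ * ⟪m, y⟫ ≤ b / ⟪u, y⟫ * 1 := by
    gcongr
    exact h.normal_inner_le hy
  have h3 : 1 - (balanceConst d + 1) * η ≤ b / ⟪u, y⟫ := by linarith
  rwa [le_div_iff₀ hy0, mul_comm] at h3

/-! ### The base of the cap and the polar of the projected base -/

lemma starProjection_orthogonal_eq {v : 𝔼} (hv : ‖v‖ = 1) (y : 𝔼) :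
    (Submodule.span ℝ {v})ᗮ.starProjection y = y - ⟪v, y⟫ • v := by
  rw [Submodule.starProjection_orthogonal_val, Submodule.starProjection_unit_singleton ℝ hv]

lemma mem_horizontalPolar_verticalProj {v : 𝔼} (hv : ‖v‖ = 1) {S : Set 𝔼} {q : 𝔼} :
    q ∈ horizontalPolar v (verticalProj v S) ↔ ⟪v, q⟫ = 0 ∧ ∀ y ∈ S, ⟪q, y⟫ ≤ 1 := by
  simp only [horizontalPolar, verticalProj, mem_ofPred_eq, forall_mem_image]
  refine and_congr_right fun hq => forall₂_congr fun y _ => ?_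
  have hq' : ⟪q, v⟫ = 0 := by rw [real_inner_comm]; exact hq
  rw [starProjection_orthogonal_eq hv, inner_sub_right, real_inner_smul_right, hq', mul_zero,
    sub_zero]

namespace IsThinCap

variable {ρ H s η b : ℝ} {K : Set (EuclideanSpace ℝ (Fin d))}
  {v m u : EuclideanSpace ℝ (Fin d)}

lemma height_mul_le (h : IsThinCap ρ K v m H s η u b) : s * H ≤ 1 := by
  linarith [h.depth_eq, h.depth_pos]

lemma depth_le_half (h : IsThinCap ρ K v m H s η u b) : η ≤ 1 / 2 := by
  nlinarith [h.depth_le, h.depth_pos, balanceConst_pos d]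

lemma height_le_inv (h : IsThinCap ρ K v m H s η u b) : s ≤ 1 / ρ := by
  rw [le_div_iff₀ h.pos]
  exact (mul_le_mul_of_nonneg_left h.toIsSupported.le_height h.height_nonneg).trans h.height_mul_le

lemma half_le_height (h : IsThinCap ρ K v m H s η u b) : ρ / 2 ≤ s := by
  have h1 : 1 / 2 ≤ s * H := by linarith [h.depth_eq, h.depth_le_half]
  have h2 : s * H ≤ s * (1 / ρ) := mul_le_mul_of_nonneg_left h.toIsSupported.height_le h.height_nonneg
  have h3 : 1 / 2 ≤ s / ρ := by rw [mul_one_div] at h2; linarith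
  rw [le_div_iff₀ h.pos] at h3
  linarith

/-- Points of the polar body are at most twice as high above the origin as the base. -/
lemma inner_le_two_mul (h : IsThinCap ρ K v m H s η u b) {y : 𝔼} (hy : y ∈ polar K) :
    ⟪u, y⟫ ≤ 2 * b := by
  have h1 := h.width_le y hy
  have h2 := h.depth_le
  have h3 := h.base_pos
  by_contra! hlt
  nlinarith

lemma half_le_base (h : IsThinCap ρ K v m H s η u b) : ρ / 2 ≤ b := by
  have h1 := h.inner_le_two_mul (y := ρ • u) (closedBall_subset_polar h.pos h.subset_ball (by
    rw [mem_closedBall_zero_iff, norm_smul, h.norm_normal, Real.norm_of_nonneg h.pos.le, mul_one]))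
  rw [real_inner_smul_right, real_inner_self_eq_norm_sq, h.norm_normal] at h1
  linarith

lemma inner_axis_pos (h : IsThinCap ρ K v m H s η u b) : 0 < ⟪u, v⟫ := by
  have h1 := h.base_pos
  rw [← h.inner_axis] at h1
  exact pos_of_mul_pos_right h1 h.height_nonneg

lemma le_inner_axis (h : IsThinCap ρ K v m H s η u b) : ρ ^ 2 / 2 ≤ ⟪u, v⟫ := by
  have h1 := h.half_le_base
  have h2 : s * ⟪u, v⟫ ≤ 1 / ρ * ⟪u, v⟫ :=
    mul_le_mul_of_nonneg_right h.height_le_inv h.inner_axis_pos.le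
  rw [h.inner_axis, one_div_mul_eq_div] at h2
  have h3 := h1.trans h2
  rw [le_div_iff₀ h.pos] at h3
  linarith

/-- Let `w` be the polar of the hyperplane through `v / a` parallel to the base of the thin cap.
On a base point `y` of the thin cap the functional `w` takes the value `a s`, so a base point `p`
of the cap of `K` satisfies `⟪p - w, y⟫ ≤ 1 - a s`, which is of order `ε`. -/
lemma sub_mem_smul_horizontalPolar (h : IsThinCap ρ K v m H s η u b) {a ε : ℝ} (hε : 0 < ε)
    (haH : a = H - ε) (hηε : ρ * η ≤ ε) {p : 𝔼} (hp : p ∈ K) (hpa : ⟪v, p⟫ = a) :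
    p - (a / ⟪u, v⟫) • u ∈
      (2 / ρ * ε) • horizontalPolar v (verticalProj v (capBase (polar K) u b)) := by
  have hβ := h.inner_axis_pos
  have hρ := h.pos
  have hc : 0 < 2 / ρ * ε := by positivity
  rw [mem_smul_set_iff_inv_smul_mem₀ hc.ne', mem_horizontalPolar_verticalProj h.norm_eq]
  constructor
  · rw [real_inner_smul_right, inner_sub_right, hpa, real_inner_smul_right, real_inner_comm u v]
    field_simp
    ring
  · rintro y ⟨hyb, hyL⟩
    have hyb : ⟪u, y⟫ = b := hyb
    have h1 : ⟪p, y⟫ ≤ 1 := by rw [real_inner_comm]; exact hyL p hp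
    rw [real_inner_smul_left, inner_sub_left, real_inner_smul_left, hyb, ← h.inner_axis,
      inv_mul_le_iff₀ hc, mul_one]
    have h2 : a / ⟪u, v⟫ * (s * ⟪u, v⟫) = a * s := by field_simp
    have h3 : a * s = 1 - η - ε * s := by rw [haH, h.depth_eq]; ring
    have h4 : η ≤ ε / ρ := by rw [le_div_iff₀ hρ]; linarith
    have h5 : ε * s ≤ ε * (1 / ρ) := mul_le_mul_of_nonneg_left h.height_le_inv hε.le
    rw [h2, h3]
    have h6 : 2 / ρ * ε = ε / ρ + ε * (1 / ρ) := by ring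
    linarith

/-- Conversely, if `⟪q, ·⟫` is at most a small multiple of `ε` on the base of the thin cap, then
`⟪w + q, ·⟫ ≤ 1` on all of `polar K`: points beyond the base are projected to it from the origin,
and points below the base from the upper end `v / H` of the axis. At both centres `⟪q, ·⟫`
vanishes, and `⟪w, ·⟫` is at most `1` minus a multiple of `ε` on the cap since it is thin. -/
lemma add_mem_of_mem_horizontalPolar (h : IsThinCap ρ K v m H s η u b) {a ε c : ℝ} (hρ1 : ρ ≤ 1)
    (hε : 0 < ε) (ha : 0 < a) (haH : a = H - ε) (hc : 1 ≤ c)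
    (hc8 : 8 * (balanceConst d + 1) ≤ c * ρ ^ 2)
    (hη1 : ρ * (ε / c) ≤ η) (hη2 : ρ * η ≤ ε / c) {q : 𝔼}
    (hq : q ∈ (ρ ^ 7 / (8 * c) * ε) •
      horizontalPolar v (verticalProj v (capBase (polar K) u b))) :
    (a / ⟪u, v⟫) • u + q ∈ K := by
  have hβ := h.inner_axis_pos
  have hρ := h.pos
  have hH := h.toIsSupported.height_pos
  have hb := h.base_pos
  have hc0 : 0 < c := by linarith
  set c₁ : ℝ := ρ ^ 7 / (8 * c) with hc₁
  have hc₁0 : 0 < c₁ := by positivity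
  have hcε : 0 < c₁ * ε := by positivity
  rw [mem_smul_set_iff_inv_smul_mem₀ hcε.ne', mem_horizontalPolar_verticalProj h.norm_eq] at hq
  obtain ⟨hq0, hqB⟩ := hq
  have hqv : ⟪q, v⟫ = 0 := by
    rw [real_inner_smul_right, mul_eq_zero] at hq0
    rw [real_inner_comm]
    exact hq0.resolve_left (inv_pos.2 hcε).ne'
  have hqB : ∀ y ∈ polar K, ⟪u, y⟫ = b → ⟪q, y⟫ ≤ c₁ * ε := by
    intro y hy hyb
    have := hqB y ⟨hyb, hy⟩
    rwa [real_inner_smul_left, inv_mul_le_iff₀ hcε, mul_one] at this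
  have h0K : (0 : 𝔼) ∈ K := h.ball_subset (by simp [hρ.le])
  have h0L : (0 : 𝔼) ∈ polar K := closedBall_subset_polar hρ h.subset_ball (by simp [hρ.le])
  refine mem_of_forall_mem_polar h.convex h.isClosed h0K fun y hy => ?_
  rw [real_inner_comm, inner_add_left, real_inner_smul_left]
  have hs := h.half_le_height
  have has : a * s = 1 - η - ε * s := by rw [haH, h.depth_eq]; ring
  have hηc : η ≤ ε / (c * ρ) := by
    rw [le_div_iff₀ (by positivity)]
    rw [le_div_iff₀ hc0] at hη2
    linarith
  rcases le_or_gt b ⟪u, y⟫ with hyb | hyb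
  · -- projection from the origin
    have hy0 : 0 < ⟪u, y⟫ := hb.trans_le hyb
    have hy₀ : (b / ⟪u, y⟫) • y ∈ polar K := (convex_polar K).smul_mem_of_zero_mem h0L hy
      ⟨by positivity, by rw [div_le_one hy0]; exact hyb⟩
    have h1 := hqB _ hy₀ (by rw [real_inner_smul_right]; field_simp)
    have h2y := h.inner_le_two_mul hy
    rw [real_inner_smul_right, div_mul_eq_mul_div, div_le_iff₀ hy0] at h1
    have h2 : ⟪q, y⟫ ≤ 2 * (c₁ * ε) := by
      refine le_of_mul_le_mul_left ?_ hb
      nlinarith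
    -- the width of the cap is small compared with `ε`
    have h3 : ⟪u, y⟫ ≤ b * (1 + 2 * ((balanceConst d + 1) * η)) := by
      have h4 := h.width_le y hy
      have h5 : 0 < (balanceConst d + 1) * η :=
        mul_pos (by linarith [balanceConst_pos d]) h.depth_pos
      nlinarith
    have h4 : a / ⟪u, v⟫ * ⟪u, y⟫ ≤ a * s * (1 + 2 * ((balanceConst d + 1) * η)) := by
      calc a / ⟪u, v⟫ * ⟪u, y⟫
          ≤ a / ⟪u, v⟫ * (b * (1 + 2 * ((balanceConst d + 1) * η))) := by gcongr
        _ = _ := by rw [← h.inner_axis]; field_simp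
    have h5 : (balanceConst d + 1) * η ≤ ρ * ε / 8 := by
      calc (balanceConst d + 1) * η ≤ (c * ρ ^ 2 / 8) * (ε / (c * ρ)) := by
            refine mul_le_mul (by linarith) hηc h.depth_pos.le (by positivity)
        _ = ρ * ε / 8 := by field_simp
    have h6 : 0 < (balanceConst d + 1) * η :=
      mul_pos (by linarith [balanceConst_pos d]) h.depth_pos
    have h7 : a * s ≤ 1 := by
      rw [has]
      linarith [h.depth_pos, mul_nonneg hε.le h.height_nonneg]
    have h8 : c₁ ≤ ρ / 8 := by
      rw [hc₁, div_le_div_iff₀ (by positivity) (by norm_num)]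
      have : ρ ^ 7 ≤ ρ := pow_le_of_le_one hρ.le hρ1 (by norm_num)
      nlinarith
    have h9 : c₁ * ε ≤ ρ / 8 * ε := by gcongr
    have h10 : ε * (ρ / 2) ≤ ε * s := by gcongr
    have h11 : a * s * (2 * ((balanceConst d + 1) * η)) ≤ 2 * ((balanceConst d + 1) * η) := by
      refine mul_le_of_le_one_left (by positivity) h7
    have h12 := h.depth_pos
    linarith
  · -- projection from the upper end of the axis
    have hηH : s = (1 - η) / H := by rw [h.depth_eq]; field_simp; ring
    have hgap : ⟪u, v⟫ / H - b = ⟪u, v⟫ * η / H := by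
      rw [← h.inner_axis, hηH]
      field_simp
      ring
    have hη0 := h.depth_pos
    have hgap0 : 0 < ⟪u, v⟫ * η / H := by positivity
    obtain ⟨l, hl⟩ : ∃ l : ℝ, l = (⟪u, v⟫ / H - ⟪u, y⟫) / (⟪u, v⟫ * η / H) := ⟨_, rfl⟩
    have hlmul : l * (⟪u, v⟫ * η / H) = ⟪u, v⟫ / H - ⟪u, y⟫ := by
      rw [hl]; field_simp
    have hl1 : 1 < l := by rw [hl, one_lt_div hgap0]; linarith
    have hl0 : 0 < l := by linarith
    have htop : (1 / H) • v ∈ polar K :=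
      h.toIsSupported.axis_mem (by positivity) (by field_simp; exact le_refl _)
    have hy₀ : (1 / H) • v + (1 / l) • (y - (1 / H) • v) ∈ polar K :=
      (convex_polar K).add_smul_sub_mem htop hy
        ⟨by positivity, by rw [div_le_one hl0]; exact hl1.le⟩
    have hub : ⟪u, (1 / H) • v + (1 / l) • (y - (1 / H) • v)⟫ = b := by
      have e1 : ⟪u, (1 / H) • v + (1 / l) • (y - (1 / H) • v)⟫ =
          ⟪u, v⟫ / H - (1 / l) * (⟪u, v⟫ / H - ⟪u, y⟫) := by
        simp only [inner_add_right, inner_sub_right, real_inner_smul_right]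
        ring
      rw [e1, ← hlmul, ← mul_assoc, one_div_mul_cancel hl0.ne', one_mul, ← hgap]
      ring
    have h1 := hqB _ hy₀ hub
    have e2 : ⟪q, (1 / H) • v + (1 / l) • (y - (1 / H) • v)⟫ = (1 / l) * ⟪q, y⟫ := by
      simp only [inner_add_right, inner_sub_right, real_inner_smul_right, hqv]
      ring
    rw [e2, one_div_mul_eq_div, div_le_iff₀ hl0] at h1
    have e3 : a / ⟪u, v⟫ * ⟪u, y⟫ = 1 - ε / H - l * (a * η / H) := by
      have : ⟪u, y⟫ = ⟪u, v⟫ / H - l * (⟪u, v⟫ * η / H) := by linarith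
      rw [this, haH]
      field_simp
    rw [e3]
    have hη3 : 0 ≤ a * η / H := by positivity
    suffices hmain : c₁ * ε * l ≤ ε / H + l * (a * η / H) by linarith
    rcases le_or_gt (H / 2) a with haH2 | haH2
    · have h2 : η / 2 ≤ a * η / H := by
        rw [le_div_iff₀ hH]
        nlinarith
      have h3 : c₁ * ε ≤ ρ * (ε / c) / 2 := by
        have e4 : ρ * (ε / c) / 2 = (4 * ρ) / (8 * c) * ε := by field_simp; ring
        rw [e4, hc₁]
        gcongr
        have : ρ ^ 7 ≤ ρ := pow_le_of_le_one hρ.le hρ1 (by norm_num)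
        linarith
      have h4 : c₁ * ε ≤ a * η / H := by linarith
      have h5 : c₁ * ε * l ≤ a * η / H * l := by gcongr
      have h6 : 0 < ε / H := by positivity
      linarith
    · -- here `ε` is bounded below, hence so is the distance from the base to `v / H`
      have hρH := h.toIsSupported.le_height
      have hHρ := h.toIsSupported.height_le
      have hε2 : ρ / 2 ≤ ε := by linarith
      have hHinv : ρ ≤ 1 / H := by
        rw [le_div_iff₀ hH]
        rw [le_div_iff₀ hρ] at hHρ
        linarith
      have h2 : ρ ^ 5 / (4 * c) ≤ ⟪u, v⟫ * η / H := by
        calc ρ ^ 5 / (4 * c) = ρ ^ 2 / 2 * (ρ * (ρ / 2 / c)) * ρ := by field_simp; ring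
          _ ≤ ⟪u, v⟫ * η * (1 / H) := by
            refine mul_le_mul (mul_le_mul h.le_inner_axis ?_ (by positivity) hβ.le) hHinv hρ.le
              (by positivity)
            refine le_trans ?_ hη1
            gcongr
          _ = ⟪u, v⟫ * η / H := by ring
      have h3 : ⟪u, v⟫ / H - ⟪u, y⟫ ≤ 2 / ρ := by
        have hbd : ∀ z ∈ polar K, |⟪u, z⟫| ≤ 1 / ρ := by
          intro z hz
          have h4 := abs_real_inner_le_norm u z
          rw [h.norm_normal, one_mul] at h4
          have h5 := polar_subset_closedBall hρ h.ball_subset hz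
          rw [mem_closedBall_zero_iff] at h5
          exact h4.trans h5
        have h4 := abs_le.1 (hbd _ htop)
        have h5 := abs_le.1 (hbd _ hy)
        rw [real_inner_smul_right, one_div_mul_eq_div] at h4
        have e5 : 2 / ρ = 1 / ρ + 1 / ρ := by ring
        linarith [h4.2, h5.1]
      have h4 : l * (ρ ^ 5 / (4 * c)) ≤ 2 / ρ :=
        (mul_le_mul_of_nonneg_left h2 hl0.le).trans (hlmul.le.trans h3)
      have h5 : c₁ * l ≤ ρ := by
        have e6 : c₁ * l = ρ ^ 2 / 2 * (l * (ρ ^ 5 / (4 * c))) := by rw [hc₁]; field_simp; ring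
        rw [e6]
        calc ρ ^ 2 / 2 * (l * (ρ ^ 5 / (4 * c))) ≤ ρ ^ 2 / 2 * (2 / ρ) := by gcongr
          _ = ρ := by field_simp
      have h6 : c₁ * ε * l ≤ ε / H := by
        calc c₁ * ε * l = ε * (c₁ * l) := by ring
          _ ≤ ε * (1 / H) := by gcongr; exact h5.trans hHinv
          _ = ε / H := by ring
      have h7 : 0 ≤ l * (a * η / H) := by positivity
      linarith

end IsThinCap

/-! ### Volume estimates -/

namespace IsThinCap

variable {ρ H s η b : ℝ} {K : Set (EuclideanSpace ℝ (Fin d))}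
  {v m u : EuclideanSpace ℝ (Fin d)}

lemma axis_mem_base (h : IsThinCap ρ K v m H s η u b) : s • v ∈ capBase (polar K) u b :=
  ⟨show ⟪u, s • v⟫ = b by rw [real_inner_smul_right]; exact h.inner_axis,
    interior_subset h.mem_interior_polar⟩

/-- The prism over the base of the thin cap, with axis `v`, is sheared onto the prism over its
vertical projection. -/
lemma volume_prism_base (h : IsThinCap ρ K v m H s η u b) :
    volume (prism ((fun y => y - s • v) '' capBase (polar K) u b) v) =
      volume (prism (verticalProj v (capBase (polar K) u b)) v) := by
  have hβ := h.inner_axis_pos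
  have hv := h.norm_eq
  have hvv : ⟪v, v⟫ = 1 := by rw [real_inner_self_eq_norm_sq, hv, one_pow]
  set n : 𝔼 := (1 / ⟪u, v⟫) • u - v with hn
  have hnv : ⟪n, v⟫ = 0 := by
    rw [hn, inner_sub_left, real_inner_smul_left, hvv, one_div_mul_cancel hβ.ne', sub_self]
  have happ : ∀ y ∈ capBase (polar K) u b, ∀ τ : ℝ,
      rankOneMap 1 n v ((y - s • v) + τ • v) = (y - ⟪v, y⟫ • v) + τ • v := by
    rintro y ⟨hyb, -⟩ τ
    have hyb : ⟪u, y⟫ = b := hyb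
    have h1 : ⟪n, (y - s • v) + τ • v⟫ = s - ⟪v, y⟫ := by
      rw [inner_add_right, inner_sub_right, real_inner_smul_right, real_inner_smul_right, hnv, hn,
        inner_sub_left, real_inner_smul_left, hyb, ← h.inner_axis]
      field_simp
      ring
    rw [rankOneMap_apply, h1]
    module
  have himage : rankOneMap 1 n v '' prism ((fun y => y - s • v) '' capBase (polar K) u b) v =
      prism (verticalProj v (capBase (polar K) u b)) v := by
    ext z
    constructor
    · rintro ⟨_, ⟨_, ⟨y, hy, rfl⟩, τ, hτ, rfl⟩, rfl⟩
      exact ⟨_, ⟨y, hy, rfl⟩, τ, hτ, by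
        beta_reduce; rw [happ y hy, starProjection_orthogonal_eq hv]⟩
    · rintro ⟨_, ⟨y, hy, rfl⟩, τ, hτ, rfl⟩
      refine ⟨(y - s • v) + τ • v, ⟨_, ⟨y, hy, rfl⟩, τ, hτ, rfl⟩, ?_⟩
      beta_reduce
      rw [happ y hy, starProjection_orthogonal_eq hv]
  rw [← himage, volume_image_rankOneMap one_ne_zero, hnv]
  simp

lemma isCompact_prism (h : IsThinCap ρ K v m H s η u b) :
    IsCompact (prism (verticalProj v (capBase (polar K) u b)) v) := by
  have hB : IsCompact (capBase (polar K) u b) :=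
    (isCompact_polar h.pos h.ball_subset).inter_left
      (isClosed_eq (f := fun p : 𝔼 => (⟪u, p⟫ : ℝ)) (by fun_prop) continuous_const)
  have hX : IsCompact (verticalProj v (capBase (polar K) u b)) :=
    hB.image ((Submodule.span ℝ {v})ᗮ.starProjection).continuous
  have hI : prism (verticalProj v (capBase (polar K) u b)) v =
      (fun z : 𝔼 × ℝ => z.1 + z.2 • v) ''
        (verticalProj v (capBase (polar K) u b) ×ˢ Icc (-1) 1) := by
    ext z
    constructor
    · rintro ⟨q, hq, τ, hτ, rfl⟩
      exact ⟨(q, τ), ⟨hq, abs_le.1 hτ⟩, rfl⟩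
    · rintro ⟨⟨q, τ⟩, ⟨hq, hτ⟩, rfl⟩
      exact ⟨q, hq, τ, abs_le.2 hτ, rfl⟩
  rw [hI]
  exact (hX.prod isCompact_Icc).image (by fun_prop)

lemma exists_closedBall_subset_prism (h : IsThinCap ρ K v m H s η u b) :
    ∃ r : ℝ, 0 < r ∧
      closedBall 0 r ⊆ prism (verticalProj v (capBase (polar K) u b)) v := by
  have hβ := h.inner_axis_pos
  have hv := h.norm_eq
  obtain ⟨r, hr, hball⟩ := Metric.isOpen_iff.1 isOpen_interior _ h.mem_interior_polar
  set β : ℝ := ⟪u, v⟫ with hβdef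
  refine ⟨min 1 (r / (4 * (1 + 1 / β))), by positivity, fun z hz => ?_⟩
  rw [mem_closedBall_zero_iff] at hz
  have hz1 : ‖z‖ ≤ 1 := hz.trans (min_le_left _ _)
  have hz2 : ‖z‖ * (4 * (1 + 1 / β)) ≤ r := by
    rw [← le_div_iff₀ (by positivity)]
    exact hz.trans (min_le_right _ _)
  have hvz : |⟪v, z⟫| ≤ ‖z‖ := by
    have := abs_real_inner_le_norm v z
    rwa [hv, one_mul] at this
  -- `q` is the horizontal part of `z`, lifted to the base along `v`
  set q : 𝔼 := z - ⟪v, z⟫ • v with hq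
  have hqn : ‖q‖ ≤ 2 * ‖z‖ := by
    calc ‖q‖ ≤ ‖z‖ + ‖⟪v, z⟫ • v‖ := norm_sub_le _ _
      _ ≤ ‖z‖ + ‖z‖ := by
        gcongr
        rw [norm_smul, hv, mul_one]
        exact hvz
      _ = 2 * ‖z‖ := by ring
  have hvq : ⟪v, q⟫ = 0 := by
    rw [hq, inner_sub_right, real_inner_smul_right, real_inner_self_eq_norm_sq, hv]; ring
  have huq : |⟪u, q⟫| ≤ ‖q‖ := by
    have := abs_real_inner_le_norm u q
    rwa [h.norm_normal, one_mul] at this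
  set y : 𝔼 := s • v + (q - (⟪u, q⟫ / β) • v) with hy
  have hyL : y ∈ polar K := by
    refine interior_subset (hball ?_)
    rw [mem_ball, dist_eq_norm, hy, add_sub_cancel_left]
    have h1 : ‖q - (⟪u, q⟫ / β) • v‖ ≤ ‖q‖ * (1 + 1 / β) := by
      calc _ ≤ ‖q‖ + ‖(⟪u, q⟫ / β) • v‖ := norm_sub_le _ _
        _ = ‖q‖ + |⟪u, q⟫| / β := by
          rw [norm_smul, hv, mul_one, Real.norm_eq_abs, abs_div, abs_of_pos hβ]
        _ ≤ ‖q‖ + ‖q‖ / β := by gcongr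
        _ = _ := by ring
    have h2 : ‖q‖ * (1 + 1 / β) ≤ 2 * ‖z‖ * (1 + 1 / β) := by gcongr
    linarith
  have hyb : ⟪u, y⟫ = b := by
    rw [hy, inner_add_right, inner_sub_right, real_inner_smul_right, real_inner_smul_right,
      ← hβdef, ← h.inner_axis, ← hβdef]
    field_simp
    ring
  refine ⟨_, ⟨y, ⟨hyb, hyL⟩, rfl⟩, ⟪v, z⟫, hvz.trans hz1, ?_⟩
  beta_reduce
  rw [starProjection_orthogonal_eq hv]
  have h3 : ⟪v, y⟫ = s - ⟪u, q⟫ / β := by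
    rw [hy, inner_add_right, inner_sub_right, real_inner_smul_right, real_inner_smul_right, hvq,
      real_inner_self_eq_norm_sq, hv]
    ring
  rw [h3, hy, hq]
  module

lemma inner_eq_zero_of_mem_verticalProj (h : IsThinCap ρ K v m H s η u b) {S : Set 𝔼} {p : 𝔼}
    (hp : p ∈ verticalProj v S) : ⟪v, p⟫ = 0 := by
  obtain ⟨y, -, rfl⟩ := hp
  beta_reduce
  rw [starProjection_orthogonal_eq h.norm_eq, inner_sub_right, real_inner_smul_right,
    real_inner_self_eq_norm_sq, h.norm_eq]
  ring

lemma zero_mem_verticalProj (h : IsThinCap ρ K v m H s η u b) :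
    (0 : 𝔼) ∈ verticalProj v (capBase (polar K) u b) := by
  refine ⟨_, h.axis_mem_base, ?_⟩
  beta_reduce
  rw [starProjection_orthogonal_eq h.norm_eq, real_inner_smul_right, real_inner_self_eq_norm_sq,
    h.norm_eq]
  simp

/-- The polar of the prism over `X` is contained in the prism over the polar of `X`. -/
lemma polar_prism_subset (h : IsThinCap ρ K v m H s η u b) :
    polar (prism (verticalProj v (capBase (polar K) u b)) v) ⊆
      prism (horizontalPolar v (verticalProj v (capBase (polar K) u b))) v := by
  intro y hy
  have hvv : ⟪v, v⟫ = 1 := by rw [real_inner_self_eq_norm_sq, h.norm_eq, one_pow]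
  refine ⟨y - ⟪v, y⟫ • v, ⟨?_, fun p hp => ?_⟩, ⟪v, y⟫, ?_, by module⟩
  · rw [inner_sub_right, real_inner_smul_right, hvv]; ring
  · have h1 := hy p ⟨p, hp, 0, by simp, by simp⟩
    rwa [inner_sub_left, real_inner_smul_left, h.inner_eq_zero_of_mem_verticalProj hp, mul_zero,
      sub_zero]
  · rw [real_inner_comm, abs_le]
    have h1 := hy ((1 : ℝ) • v) ⟨0, h.zero_mem_verticalProj, 1, by simp, by simp⟩
    have h2 := hy ((-1 : ℝ) • v) ⟨0, h.zero_mem_verticalProj, -1, by simp, by simp⟩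
    rw [real_inner_smul_right] at h1 h2
    constructor <;> linarith

/-- The prism over the polar of `X` is contained in twice the polar of the prism over `X`. -/
lemma prism_polar_subset (h : IsThinCap ρ K v m H s η u b) :
    prism (horizontalPolar v (verticalProj v (capBase (polar K) u b))) v ⊆
      (2 : ℝ) • polar (prism (verticalProj v (capBase (polar K) u b)) v) := by
  rintro _ ⟨q, ⟨hqv, hq⟩, τ, hτ, rfl⟩
  rw [mem_smul_set_iff_inv_smul_mem₀ two_ne_zero]
  rintro _ ⟨p, hp, ν, hν, rfl⟩
  have h1 : ⟪q + τ • v, p + ν • v⟫ = ⟪q, p⟫ + τ * ν := by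
    have e1 : ⟪q, v⟫ = 0 := by rw [real_inner_comm]; exact hqv
    have e2 := h.inner_eq_zero_of_mem_verticalProj hp
    have e3 : ⟪v, v⟫ = 1 := by rw [real_inner_self_eq_norm_sq, h.norm_eq, one_pow]
    simp only [inner_add_left, inner_add_right, real_inner_smul_left, real_inner_smul_right, e1, e2,
      e3]
    ring
  rw [real_inner_smul_left, h1]
  have h2 : τ * ν ≤ 1 := by
    refine (le_abs_self _).trans ?_
    rw [abs_mul]
    exact mul_le_one₀ hτ (abs_nonneg _) hν
  linarith [hq p hp]

/-- The balance of the thin cap, expressed for the prism over its projected base. -/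
lemma neg_le_inner_of_mem_polar_prism (h : IsThinCap ρ K v m H s η u b) :
    ∀ y ∈ polar (prism (verticalProj v (capBase (polar K) u b)) v),
      ∀ z ∈ prism (verticalProj v (capBase (polar K) u b)) v, -(balanceConst d + 1) ≤ ⟪y, z⟫ := by
  intro y hy z hz
  obtain ⟨q, hq, τ, hτ, rfl⟩ := h.polar_prism_subset hy
  obtain ⟨p, hp, ν, hν, rfl⟩ := hz
  obtain ⟨hqv, hqX⟩ := (mem_horizontalPolar_verticalProj h.norm_eq).1 hq
  have e1 : ⟪q, v⟫ = 0 := by rw [real_inner_comm]; exact hqv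
  have e2 := h.inner_eq_zero_of_mem_verticalProj hp
  have e3 : ⟪v, v⟫ = 1 := by rw [real_inner_self_eq_norm_sq, h.norm_eq, one_pow]
  have h1 : ⟪q + τ • v, p + ν • v⟫ = ⟪q, p⟫ + τ * ν := by
    simp only [inner_add_left, inner_add_right, real_inner_smul_left, real_inner_smul_right, e1, e2,
      e3]
    ring
  have h2 : -1 ≤ τ * ν := by
    refine neg_le_of_abs_le ?_
    rw [abs_mul]
    exact mul_le_one₀ hτ (abs_nonneg _) hν
  have e4 : ∀ y : 𝔼, ⟪q, y - s • v⟫ = ⟪q, y⟫ := by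
    intro y
    rw [inner_sub_right, real_inner_smul_right, e1]; ring
  obtain ⟨y₀, ⟨hy₀b, hy₀L⟩, rfl⟩ := hp
  have h3 := h.balanced q 1 one_pos (fun y hy hyb => by rw [e4]; exact hqX y ⟨hyb, hy⟩) y₀ hy₀L hy₀b
  rw [h1]
  beta_reduce
  rw [starProjection_orthogonal_eq h.norm_eq, inner_sub_right, real_inner_smul_right, e1, mul_zero,
    sub_zero]
  rw [e4] at h3
  linarith

lemma dimension_pos (h : IsThinCap ρ K v m H s η u b) : 0 < d := by
  rcases Nat.eq_zero_or_pos d with rfl | hd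
  · have := h.norm_eq
    rw [Subsingleton.elim v 0, norm_zero] at this
    exact (zero_ne_one this).elim
  · exact hd

/-- The volume product of the prisms over `X` and over its polar is bounded from below. -/
lemma le_volume_prism_mul (h : IsThinCap ρ K v m H s η u b) :
    ENNReal.ofReal ((1 / d) ^ d * (2 / d) ^ d) ≤
      volume (prism (horizontalPolar v (verticalProj v (capBase (polar K) u b))) v) *
        volume (prism (verticalProj v (capBase (polar K) u b)) v) := by
  obtain ⟨r, hr, hball⟩ := h.exists_closedBall_subset_prism
  rw [mul_comm (volume _)]
  refine (le_volume_mul_volume_polar h.dimension_pos h.isCompact_prism (convex_prism ?_ v) hr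
    hball).trans (mul_le_mul_right (measure_mono h.polar_prism_subset) _)
  exact (convex_capBase K u b).is_linear_image
    ((Submodule.span ℝ {v})ᗮ.starProjection).toLinearMap.isLinear

/-- The volume product of the prisms over `X` and over its polar is bounded from above, since the
base of a minimum volume cap is balanced. -/
lemma volume_prism_mul_le (h : IsThinCap ρ K v m H s η u b) :
    volume (prism (horizontalPolar v (verticalProj v (capBase (polar K) u b))) v) *
        volume (prism (verticalProj v (capBase (polar K) u b)) v) ≤
      ENNReal.ofReal (2 ^ d * (2 ^ d * (balanceConst d + 2) ^ d)) := by
  obtain ⟨r, hr, hball⟩ := h.exists_closedBall_subset_prism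
  have hκ := balanceConst_pos d
  have h1 := volume_mul_volume_polar_le h.isCompact_prism hr hball
    (κ := balanceConst d + 1) (by positivity) h.neg_le_inner_of_mem_polar_prism
  have h2 := measure_mono (μ := volume) h.prism_polar_subset
  rw [Measure.addHaar_smul, finrank_euclideanSpace, Fintype.card_fin,
    abs_of_pos (by positivity)] at h2
  calc _ ≤ ENNReal.ofReal (2 ^ d) * volume (polar (prism (verticalProj v (capBase (polar K) u b)) v))
          * volume (prism (verticalProj v (capBase (polar K) u b)) v) := by gcongr
    _ ≤ ENNReal.ofReal (2 ^ d) * ENNReal.ofReal (2 ^ d * (balanceConst d + 1 + 1) ^ d) := by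
        rw [mul_assoc, mul_comm (volume (polar _))]
        gcongr
    _ = _ := by
        rw [← ENNReal.ofReal_mul (by positivity)]
        congr 4
        ring

/-- The volume of the thin cap is of the order of `ε` times the volume of the prism over its
projected base, as the width of the cap is of the order of `ε`. -/
lemma volume_cap_bounds (h : IsThinCap ρ K v m H s η u b) {ε c : ℝ} (hε : 0 < ε) (hc : 1 ≤ c)
    (hη1 : ρ * (ε / c) ≤ η) (hη2 : ρ * η ≤ ε / c) :
    ENNReal.ofReal ((1 / 2) ^ d * (ρ ^ 2 / (2 * c)) * ε) *
        volume (prism (verticalProj v (capBase (polar K) u b)) v) ≤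
      volume (cap (polar K) u b) ∧
    volume (cap (polar K) u b) ≤
      ENNReal.ofReal (2 ^ d * ((balanceConst d + 1) / ρ ^ 2) * ε) *
        volume (prism (verticalProj v (capBase (polar K) u b)) v) := by
  have hβ := h.inner_axis_pos
  have hρ := h.pos
  have hH := h.toIsSupported.height_pos
  have hη0 := h.depth_pos
  have hb := h.base_pos
  have hκ := balanceConst_pos d
  have hc0 : 0 < c := by linarith
  have hsL := h.axis_mem_base.2
  obtain ⟨p, hpL, hpmax⟩ := (isCompact_polar h.pos h.ball_subset).exists_isMaxOn ⟨_, hsL⟩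
    (f := fun y => (⟪u, y⟫ : ℝ)) (by fun_prop)
  have hpmax : ∀ y ∈ polar K, ⟪u, y⟫ ≤ ⟪u, p⟫ := hpmax
  set β : ℝ := ⟪u, v⟫ with hβdef
  have hsβ : s * β = b := h.inner_axis
  set n : 𝔼 := (1 / β) • u with hn
  have hninner : ∀ y : 𝔼, ⟪n, y⟫ = ⟪u, y⟫ / β := by
    intro y; rw [hn, real_inner_smul_left]; ring
  have hnv : ⟪n, v⟫ = 1 := by rw [hninner, ← hβdef, div_self hβ.ne']
  have hsb : b / β = s := by rw [← hsβ]; field_simp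
  set T : Set 𝔼 := (fun y => y - s • v) '' capBase (polar K) u b with hT
  have hT0 : ∀ q ∈ T, ⟪n, q⟫ = 0 := by
    rintro _ ⟨y, ⟨hyb, -⟩, rfl⟩
    have hyb : ⟪u, y⟫ = b := hyb
    beta_reduce
    rw [inner_sub_right, real_inner_smul_right, hnv, hninner, hyb, hsb]
    ring
  have hstar : ∀ q ∈ T, ∀ r : ℝ, 0 ≤ r → r ≤ 1 → r • q ∈ T := by
    rintro _ ⟨y, hy, rfl⟩ r hr0 hr1
    refine ⟨s • v + r • (y - s • v),
      (convex_capBase K u b).add_smul_sub_mem h.axis_mem_base hy ⟨hr0, hr1⟩, ?_⟩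
    beta_reduce
    rw [add_sub_cancel_left]
  obtain ⟨ω, hω⟩ : ∃ ω : ℝ, ω = ⟪u, p⟫ / β - s := ⟨_, rfl⟩
  have hωlow : ρ ^ 2 / c * ε ≤ ω := by
    have htop : (1 / H) • v ∈ polar K :=
      h.toIsSupported.axis_mem (by positivity) (by field_simp; exact le_refl _)
    have h1 := hpmax _ htop
    rw [real_inner_smul_right, ← hβdef, ← le_div_iff₀ hβ] at h1
    have h2 : 1 / H - s = η / H := by rw [h.depth_eq]; field_simp
    have h3 : ρ ≤ 1 / H := by
      rw [le_div_iff₀ hH]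
      have := h.toIsSupported.height_le
      rw [le_div_iff₀ hρ] at this
      linarith
    calc ρ ^ 2 / c * ε = ρ * (ε / c) * ρ := by ring
      _ ≤ η * (1 / H) := by gcongr
      _ = η / H := by ring
      _ ≤ ω := by rw [hω, ← h2]; linarith
  have hω0 : 0 < ω := lt_of_lt_of_le (by positivity) hωlow
  have hωup : ω ≤ 2 * ((balanceConst d + 1) / ρ ^ 2) * ε := by
    have h1 := h.width_le p hpL
    have h2 := h.inner_le_two_mul hpL
    have h3 : ⟪u, p⟫ - b ≤ 2 * b * ((balanceConst d + 1) * η) := by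
      have : ⟪u, p⟫ * ((balanceConst d + 1) * η) ≤ 2 * b * ((balanceConst d + 1) * η) := by gcongr
      linarith
    have h4 : η ≤ ε / ρ := by
      rw [le_div_iff₀ hρ, mul_comm]
      exact hη2.trans (div_le_self hε.le hc)
    calc ω = (⟪u, p⟫ - b) / β := by rw [hω, ← hsb]; ring
      _ ≤ 2 * b * ((balanceConst d + 1) * η) / β := by gcongr
      _ = 2 * ((balanceConst d + 1) * η) * s := by rw [← hsβ]; field_simp
      _ ≤ 2 * ((balanceConst d + 1) * (ε / ρ)) * (1 / ρ) := by
          gcongr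
          · exact h.height_nonneg
          · exact h.height_le_inv
      _ = _ := by field_simp
  have hns : ⟪n, s • v⟫ = s := by rw [real_inner_smul_right, hnv, mul_one]
  have hcap : cap (polar K) u b = polar K ∩ {y | s ≤ ⟪n, y⟫} := by
    ext y
    refine and_congr_right fun _ => ?_
    show b ≤ ⟪u, y⟫ ↔ s ≤ ⟪n, y⟫
    rw [hninner, le_div_iff₀ hβ, hsβ]
  have h0L : (0 : 𝔼) ∈ polar K := closedBall_subset_polar hρ h.subset_ball (by simp [hρ.le])
  have hs0 : 0 < s := (half_pos hρ).trans_le h.half_le_height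
  rw [hcap, ← h.volume_prism_base]
  constructor
  · refine le_trans ?_ (prism_le_volume_cap (convex_polar K) hnv hT0 hstar hω0 one_pos hpL
      (by rw [hninner, hω]; ring) hns ?_)
    · refine mul_le_mul_left (ENNReal.ofReal_le_ofReal ?_) _
      rw [mul_assoc]
      gcongr
      calc ρ ^ 2 / (2 * c) * ε = (ρ ^ 2 / c * ε) / 2 := by field_simp
        _ ≤ ω / 2 := by gcongr
        _ = ω / 4 / (1 / 2) := by ring
    · rintro _ ⟨y, hy, rfl⟩
      simpa using hy.2
  · refine (volume_cap_le_prism (convex_polar K) (ω := ω) (α := 1) (R := 2) hnv hT0 hstar hω0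
      one_pos two_pos h0L (by rw [inner_zero_right]; exact hs0) hns ?_ ?_ ?_).trans ?_
    · intro y hy hys
      refine ⟨y - s • v, ⟨y, ⟨?_, hy⟩, rfl⟩, by module⟩
      show ⟪u, y⟫ = b
      rw [hninner, div_eq_iff hβ.ne', hsβ] at hys
      exact hys
    · intro y hy
      rw [hninner, hω, add_sub_cancel]
      gcongr
      exact hpmax y hy
    · rw [inner_zero_right, sub_zero, sub_zero, hω, add_sub_cancel, ← hsb, ← mul_div_assoc]
      gcongr
      exact h.inner_le_two_mul hpL
    · refine mul_le_mul_left (ENNReal.ofReal_le_ofReal ?_) _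
      rw [mul_one, mul_assoc]
      gcongr
      linarith

end IsThinCap

/-- Lower bound for the volume product of a convex body in dimension `d` and its polar. -/
noncomputable def volumeProductLower (d : ℕ) : ℝ := (1 / d) ^ d * (2 / d) ^ d

/-- Upper bound for the volume product of prisms over a balanced set and over its polar. -/
noncomputable def volumeProductUpper (d : ℕ) : ℝ := 2 ^ d * (2 ^ d * (balanceConst d + 2) ^ d)

lemma volumeProductLower_pos (d : ℕ) : 0 < volumeProductLower d := by
  unfold volumeProductLower
  rcases Nat.eq_zero_or_pos d with rfl | hd
  · simp
  · have : (0 : ℝ) < d := by exact_mod_cast hd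
    positivity

lemma volumeProductUpper_pos (d : ℕ) : 0 < volumeProductUpper d := by
  have := balanceConst_pos d
  unfold volumeProductUpper
  positivity

namespace IsThinCap

variable {ρ H s η b : ℝ} {K : Set (EuclideanSpace ℝ (Fin d))}
  {v m u : EuclideanSpace ℝ (Fin d)}

/-- Up to constants, a cap of `K` of width `ε` whose base is a translate of `ε X*` has volume
`ε ^ d` times the volume of the prism over `X*`. -/
lemma volume_primal_cap_bounds (h : IsThinCap ρ K v m H s η u b) {a ε c₁ c₂ : ℝ} (hρ1 : ρ ≤ 1)
    (hε : 0 < ε) (ha : 0 < a) (haH : a = H - ε) (hc₁ : 0 < c₁) (hc₂ : 0 < c₂)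
    (hlow : ∀ q ∈ (c₁ * ε) • horizontalPolar v (verticalProj v (capBase (polar K) u b)),
      (a / ⟪u, v⟫) • u + q ∈ K)
    (hup : ∀ p ∈ K, ⟪v, p⟫ = a → p - (a / ⟪u, v⟫) • u ∈
      (c₂ * ε) • horizontalPolar v (verticalProj v (capBase (polar K) u b))) :
    ENNReal.ofReal ((c₁ / 2) ^ d * (1 / (2 * c₁)) * ε ^ d) *
        volume (prism (horizontalPolar v (verticalProj v (capBase (polar K) u b))) v) ≤
      volume (cap K v a) ∧
    volume (cap K v a) ≤
      ENNReal.ofReal ((2 / ρ ^ 2 * c₂) ^ d * (1 / (2 / ρ ^ 2 * c₂)) * ε ^ d) *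
        volume (prism (horizontalPolar v (verticalProj v (capBase (polar K) u b))) v) := by
  have hβ := h.inner_axis_pos
  have hρ := h.pos
  have hvv : ⟪v, v⟫ = 1 := by rw [real_inner_self_eq_norm_sq, h.norm_eq, one_pow]
  set T : Set 𝔼 := horizontalPolar v (verticalProj v (capBase (polar K) u b)) with hT
  have hT0 : ∀ q ∈ T, ⟪v, q⟫ = 0 := fun q hq => hq.1
  have hstar : ∀ q ∈ T, ∀ r : ℝ, 0 ≤ r → r ≤ 1 → r • q ∈ T := by
    rintro q ⟨hq0, hq⟩ r hr0 hr1
    refine ⟨by rw [real_inner_smul_right, hq0, mul_zero], fun p hp => ?_⟩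
    rw [real_inner_smul_left]
    nlinarith [hq p hp]
  have hw : ⟪v, (a / ⟪u, v⟫) • u⟫ = a := by
    rw [real_inner_smul_right, real_inner_comm u v]; field_simp
  have hHa : H = a + ε := by linarith
  constructor
  · refine le_trans (le_of_eq ?_) (prism_le_volume_cap h.convex (α := c₁ * ε) hvv hT0 hstar hε
      (by positivity) h.mem (h.inner_eq.trans hHa) hw
      fun q hq => hlow _ (smul_mem_smul_set hq))
    congr 2
    have : (c₁ * ε / 2) ^ d = (c₁ / 2) ^ d * ε ^ d := by rw [← mul_pow]; ring
    rw [this]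
    field_simp
    norm_num
  · refine (volume_cap_le_prism h.convex (e := (-ρ) • v) (α := c₂ * ε) (R := 2 / ρ ^ 2) hvv hT0
      hstar hε (by positivity) (by positivity) ?_ ?_ hw ?_ ?_ ?_).trans (le_of_eq ?_)
    · refine h.ball_subset ?_
      rw [mem_closedBall_zero_iff, norm_smul, h.norm_eq, norm_neg, Real.norm_of_nonneg hρ.le,
        mul_one]
    · rw [real_inner_smul_right, hvv]; linarith
    · intro y hy hya
      obtain ⟨q, hq, hyq⟩ := hup y hy hya
      have hyq : (c₂ * ε) • q = y - (a / ⟪u, v⟫) • u := hyq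
      exact ⟨q, hq, by rw [hyq]; abel⟩
    · intro y hy
      rw [← hHa]
      exact h.inner_le y hy
    · rw [real_inner_smul_right, hvv, ← hHa]
      have h1 := h.toIsSupported.height_le
      have h2 : ρ ≤ 1 / ρ := by rw [le_div_iff₀ hρ]; nlinarith
      calc H - -ρ * 1 ≤ 1 / ρ + 1 / ρ := by linarith
        _ = 2 / ρ ^ 2 * ρ := by field_simp; norm_num
        _ ≤ 2 / ρ ^ 2 * (a - -ρ * 1) := by gcongr; linarith
    · congr 2
      have : (2 / ρ ^ 2 * (c₂ * ε)) ^ d = (2 / ρ ^ 2 * c₂) ^ d * ε ^ d := by rw [← mul_pow]; ring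
      rw [this]
      field_simp

/-- The volumes of a cap of `K` and of the thin cap of `polar K` are comparable to `ε ^ d` times the
volume of the prism over `X*` and to `ε` times the volume of the prism over `X`, respectively; the
product of the volumes of the two prisms is bounded from both sides. -/
lemma volume_product_bounds (h : IsThinCap ρ K v m H s η u b) {a ε c c₁ c₂ : ℝ} (hρ1 : ρ ≤ 1)
    (hε : 0 < ε) (ha : 0 < a) (haH : a = H - ε) (hc : 1 ≤ c) (hc₁ : 0 < c₁) (hc₂ : 0 < c₂)
    (hη1 : ρ * (ε / c) ≤ η) (hη2 : ρ * η ≤ ε / c)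
    (hlow : ∀ q ∈ (c₁ * ε) • horizontalPolar v (verticalProj v (capBase (polar K) u b)),
      (a / ⟪u, v⟫) • u + q ∈ K)
    (hup : ∀ p ∈ K, ⟪v, p⟫ = a → p - (a / ⟪u, v⟫) • u ∈
      (c₂ * ε) • horizontalPolar v (verticalProj v (capBase (polar K) u b))) :
    (c₁ / 2) ^ d * (1 / (2 * c₁)) * ((1 / 2) ^ d * (ρ ^ 2 / (2 * c))) * volumeProductLower d *
        ε ^ (d + 1) ≤ volume.real (cap K v a) * volume.real (cap (polar K) u b) ∧
    volume.real (cap K v a) * volume.real (cap (polar K) u b) ≤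
      (2 / ρ ^ 2 * c₂) ^ d * (1 / (2 / ρ ^ 2 * c₂)) * (2 ^ d * ((balanceConst d + 1) / ρ ^ 2)) *
        volumeProductUpper d * ε ^ (d + 1) := by
  have hρ := h.pos
  have hc0 : 0 < c := by linarith
  have hκ := balanceConst_pos d
  obtain ⟨hC1, hC2⟩ := h.volume_primal_cap_bounds hρ1 hε ha haH hc₁ hc₂ hlow hup
  obtain ⟨hD1, hD2⟩ := h.volume_cap_bounds hε hc hη1 hη2
  set V₁ := volume (prism (horizontalPolar v (verticalProj v (capBase (polar K) u b))) v)
  set V₂ := volume (prism (verticalProj v (capBase (polar K) u b)) v)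
  have hM1 : ENNReal.ofReal (volumeProductLower d) ≤ V₁ * V₂ := h.le_volume_prism_mul
  have hM2 : V₁ * V₂ ≤ ENNReal.ofReal (volumeProductUpper d) := h.volume_prism_mul_le
  have hL := volumeProductLower_pos d
  have hU := volumeProductUpper_pos d
  have hlower : ENNReal.ofReal ((c₁ / 2) ^ d * (1 / (2 * c₁)) *
      ((1 / 2) ^ d * (ρ ^ 2 / (2 * c))) * volumeProductLower d * ε ^ (d + 1)) ≤
      volume (cap K v a) * volume (cap (polar K) u b) := by
    refine le_trans ?_ (mul_le_mul' hC1 hD1)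
    rw [mul_mul_mul_comm (ENNReal.ofReal _), ← ENNReal.ofReal_mul (by positivity)]
    refine le_trans (le_of_eq ?_) (mul_le_mul_right hM1 _)
    rw [← ENNReal.ofReal_mul (by positivity)]
    congr 1
    ring
  have hupper : volume (cap K v a) * volume (cap (polar K) u b) ≤
      ENNReal.ofReal ((2 / ρ ^ 2 * c₂) ^ d * (1 / (2 / ρ ^ 2 * c₂)) *
        (2 ^ d * ((balanceConst d + 1) / ρ ^ 2)) * volumeProductUpper d * ε ^ (d + 1)) := by
    refine (mul_le_mul' hC2 hD2).trans ?_
    rw [mul_mul_mul_comm (ENNReal.ofReal _), ← ENNReal.ofReal_mul (by positivity)]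
    refine (mul_le_mul_right hM2 _).trans (le_of_eq ?_)
    rw [← ENNReal.ofReal_mul (by positivity)]
    congr 1
    ring
  rw [Measure.real, Measure.real, ← ENNReal.toReal_mul]
  constructor
  · exact (ENNReal.ofReal_le_iff_le_toReal (hupper.trans_lt ENNReal.ofReal_lt_top).ne).1 hlower
  · exact ENNReal.toReal_le_of_le_ofReal (by positivity) hupper

end IsThinCap

/-! ### Existence of minimum volume caps -/

lemma volume_hyperplane_eq_zero {u : 𝔼} (hu : u ≠ 0) (x : 𝔼) :
    volume {y : 𝔼 | ⟪u, y - x⟫ = 0} = 0 := by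
  have h1 : {y : 𝔼 | ⟪u, y - x⟫ = 0} =
      (fun y => y + -x) ⁻¹' (LinearMap.ker (innerₗ 𝔼 u) : Set 𝔼) := by
    ext y
    simp [sub_eq_add_neg]
  rw [h1, measure_preimage_add_right]
  refine Measure.addHaar_submodule _ _ fun htop => hu ?_
  have h2 : u ∈ LinearMap.ker (innerₗ 𝔼 u) := htop ▸ Submodule.mem_top
  simpa using h2

/-- The volume cut off by a halfspace bounded by a hyperplane through `x` depends continuously on
the normal, since the boundary hyperplanes are null sets. -/
lemma continuousAt_volume_halfspace {L : Set 𝔼} (hL : IsCompact L) (x : 𝔼) {u : 𝔼} (hu : u ≠ 0) :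
    ContinuousAt (fun n : 𝔼 => volume.real (L ∩ {y | 0 ≤ ⟪n, y - x⟫})) u := by
  have hm : ∀ n : 𝔼, MeasurableSet {y : 𝔼 | 0 ≤ ⟪n, y - x⟫} := fun n =>
    (isClosed_halfspace n x 0).measurableSet
  have h1 : (fun n : 𝔼 => volume.real (L ∩ {y | 0 ≤ ⟪n, y - x⟫})) =
      fun n => ∫ y in L, ({y : 𝔼 | 0 ≤ ⟪n, y - x⟫}).indicator (1 : 𝔼 → ℝ) y := by
    ext n
    rw [integral_indicator_one (hm n), measureReal_restrict_apply (hm n), inter_comm]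
  rw [h1]
  refine continuousAt_of_dominated (bound := fun _ => 1) ?_ ?_ ?_ ?_
  · exact Filter.Eventually.of_forall fun n =>
      (measurable_one.indicator (hm n)).aestronglyMeasurable
  · refine Filter.Eventually.of_forall fun n => Filter.Eventually.of_forall fun y => ?_
    refine (norm_indicator_le_norm_self _ _).trans ?_
    simp
  · exact integrableOn_const hL.measure_lt_top.ne
  · have hae : ∀ᵐ y ∂(volume.restrict L), ⟪u, y - x⟫ ≠ (0 : ℝ) := by
      refine ae_restrict_of_ae ?_
      rw [ae_iff]
      simpa using volume_hyperplane_eq_zero hu x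
    filter_upwards [hae] with y hy
    have hcont : Continuous fun n : 𝔼 => (⟪n, y - x⟫ : ℝ) := by fun_prop
    rcases lt_or_gt_of_ne hy with hlt | hgt
    · refine (continuousAt_const (y := (0 : ℝ))).congr ?_
      filter_upwards [hcont.continuousAt.eventually_lt continuousAt_const hlt] with n hn
      rw [indicator_of_notMem]
      exact hn.not_ge
    · refine (continuousAt_const (y := (1 : ℝ))).congr ?_
      filter_upwards [continuousAt_const.eventually_lt hcont.continuousAt hgt] with n hn
      rw [indicator_of_mem, Pi.one_apply]
      exact hn.le

lemma exists_isMinimalCap {L : Set 𝔼} (hL : IsCompact L) {x v : 𝔼} (hx : x ∈ L) (hv : ‖v‖ = 1) :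
    ∃ (u : 𝔼) (b : ℝ), IsMinimalCap L x u b := by
  obtain ⟨u, hu, hmin⟩ := (isCompact_sphere (0 : 𝔼) 1).exists_isMinOn ⟨v, by simpa using hv⟩
    (f := fun n : 𝔼 => volume.real (L ∩ {y | 0 ≤ ⟪n, y - x⟫})) (fun n hn =>
      (continuousAt_volume_halfspace hL x (by
        rintro rfl
        simp at hn)).continuousWithinAt)
  have hcap : ∀ n : 𝔼, L ∩ {y | 0 ≤ ⟪n, y - x⟫} = cap L n ⟪n, x⟫ := by
    intro n
    ext y
    refine and_congr_right fun _ => ?_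
    show 0 ≤ ⟪n, y - x⟫ ↔ ⟪n, x⟫ ≤ ⟪n, y⟫
    rw [inner_sub_right, sub_nonneg]
  refine ⟨u, ⟪u, x⟫, by simpa using hu, ⟨hx, le_refl (⟪u, x⟫ : ℝ)⟩, fun u' t' hu' hx' => ?_⟩
  have h1 : volume.real (L ∩ {y | 0 ≤ ⟪u, y - x⟫}) ≤ volume.real (L ∩ {y | 0 ≤ ⟪u', y - x⟫}) :=
    hmin (by simpa using hu' : u' ∈ sphere (0 : 𝔼) 1)
  rw [hcap, hcap] at h1
  have hfin : ∀ n t, volume (cap L n t) ≠ ⊤ := fun n t =>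
    ((measure_mono inter_subset_left).trans_lt hL.measure_lt_top).ne
  refine ((ENNReal.toReal_le_toReal (hfin _ _) (hfin _ _)).1 h1).trans (measure_mono ?_)
  exact fun y hy => ⟨hy.1, le_trans (show t' ≤ ⟪u', x⟫ from hx'.2) hy.2⟩

/-- By the intermediate value theorem the vertical axis contains a point of the polar body at any
prescribed small distance to the boundary. -/
lemma IsSupported.exists_axis_point {ρ H : ℝ} {K : Set (EuclideanSpace ℝ (Fin d))}
    {v m : EuclideanSpace ℝ (Fin d)} (h : IsSupported ρ K v m H) {δ : ℝ} (hδ : 0 ≤ δ)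
    (hδρ : δ ≤ ρ) :
    ∃ s : ℝ, 0 ≤ s ∧ s • v ∈ polar K ∧ infDist (s • v) (frontier (polar K)) = δ := by
  have hH := h.height_pos
  have h0L : ((0 : ℝ) • v) ∈ polar K := h.axis_mem le_rfl (by simp)
  have hcont : Continuous fun s : ℝ => infDist (s • v) (frontier (polar K)) := by
    exact (continuous_infDist_pt _).comp (by fun_prop)
  have h0 := (h.gap_bounds le_rfl h0L).2
  have h1 : infDist ((1 / H) • v) (frontier (polar K)) = 0 :=
    infDist_zero_of_mem h.top_mem_frontier
  obtain ⟨s, ⟨hs0, hs1⟩, hs⟩ := intermediate_value_Icc' (a := 0) (b := 1 / H) (by positivity)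
    hcont.continuousOn (show δ ∈ Icc _ _ from ⟨by beta_reduce; rw [h1]; exact hδ,
      by beta_reduce; refine le_trans ?_ h0; simpa using hδρ⟩)
  refine ⟨s, hs0, h.axis_mem hs0 ?_, hs⟩
  rwa [le_div_iff₀ hH] at hs1

/-! ### Duality of caps -/

lemma IsCanonical.exists_isSupported {γ : ℝ} (hγ : 0 < γ)
    {K : ConvexBody (EuclideanSpace ℝ (Fin d))}
    (hK : IsCanonical γ (K : Set (EuclideanSpace ℝ (Fin d)))) {v : EuclideanSpace ℝ (Fin d)}
    (hv : ‖v‖ = 1) :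
    ∃ (m : EuclideanSpace ℝ (Fin d)) (H : ℝ), IsSupported (√γ) (K : Set 𝔼) v m H ∧
      sSup ((fun p => (⟪v, p⟫ : ℝ)) '' (K : Set 𝔼)) = H := by
  obtain ⟨m, hm, hmax⟩ := K.isCompact.exists_isMaxOn K.nonempty
    (f := fun p => (⟪v, p⟫ : ℝ)) (by fun_prop)
  refine ⟨m, ⟪v, m⟫, ⟨Real.sqrt_pos.2 hγ, K.convex, K.isCompact.isClosed, hK.1, hK.2, hv, hm, rfl,
    fun p hp => hmax hp⟩, ?_⟩
  exact IsGreatest.csSup_eq ⟨⟨m, hm, rfl⟩, by rintro _ ⟨p, hp, rfl⟩; exact hmax hp⟩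

/-- Lower bound on the parameter `c`, chosen such that the point at distance `ε / c` to the
boundary exists and that its minimum volume caps avoid the origin and are thin compared with `ε`. -/
noncomputable def minRatio (d : ℕ) (γ : ℝ) : ℝ :=
  1 + (8 * (balanceConst d + 1) + 2 * (6 / γ) ^ d + 2) / γ

/-- An associated cap is thin, and the depth of its point is of the order of `ε / c`. -/
lemma IsAssociatedCap.exists_isThinCap {γ c ε H b : ℝ} (hγ : 0 < γ) (hc : minRatio d γ ≤ c)
    {K : Set (EuclideanSpace ℝ (Fin d))} {v m u : EuclideanSpace ℝ (Fin d)}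
    (h : IsSupported (√γ) K v m H) (hε : 0 < ε) (hεH : ε < H)
    (hcap : IsAssociatedCap c ε K v u b) :
    ∃ s η : ℝ, IsThinCap (√γ) K v m H s η u b ∧ √γ * (ε / c) ≤ η ∧ √γ * η ≤ ε / c := by
  obtain ⟨_, hx, ⟨s, hs, rfl⟩, hdist, hmin⟩ := hcap
  have hρ := h.pos
  have hκ := balanceConst_pos d
  have hρ2 : √γ ^ 2 = γ := Real.sq_sqrt hγ.le
  have hpow : 0 < (6 / γ) ^ d := by positivity
  have hcγ : 8 * (balanceConst d + 1) + 2 * (6 / γ) ^ d + 2 ≤ c * γ := by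
    rw [← div_le_iff₀ hγ]
    unfold minRatio at hc
    linarith
  have hc0 : 0 < c := pos_of_mul_pos_left (lt_of_lt_of_le (by positivity) hcγ) hγ.le
  obtain ⟨h1, h2⟩ := h.gap_bounds hs hx
  rw [hdist] at h1 h2
  have hη : 0 < 1 - s * H := lt_of_lt_of_le (by positivity) h1
  have h3 : (1 - s * H) * (c * γ) ≤ 1 := by
    have h4 : ε * √γ ≤ 1 := by
      have := hεH.le.trans h.height_le
      rwa [le_div_iff₀ hρ] at this
    rw [le_div_iff₀ hc0] at h2
    calc (1 - s * H) * (c * γ) = (√γ * (1 - s * H) * c) * √γ := by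
          conv_lhs => rw [← hρ2]
          ring
      _ ≤ ε * √γ := by gcongr
      _ ≤ 1 := h4
  refine ⟨s, 1 - s * H, hmin.isThinCap h hs rfl hη ?_ ?_, h1, h2⟩
  · nlinarith
  · rw [hρ2]
    nlinarith

lemma IsSupported.exists_isAssociatedCap {γ c ε H : ℝ} (hγ : 0 < γ) (hc : minRatio d γ ≤ c)
    {K : Set (EuclideanSpace ℝ (Fin d))} {v m : EuclideanSpace ℝ (Fin d)}
    (h : IsSupported (√γ) K v m H) (hε : 0 < ε) (hεH : ε < H) :
    ∃ (u : EuclideanSpace ℝ (Fin d)) (b : ℝ), IsAssociatedCap c ε K v u b := by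
  have hρ := h.pos
  have hκ := balanceConst_pos d
  have hρ2 : √γ ^ 2 = γ := Real.sq_sqrt hγ.le
  have hpow : 0 < (6 / γ) ^ d := by positivity
  have hcγ : 8 * (balanceConst d + 1) + 2 * (6 / γ) ^ d + 2 ≤ c * γ := by
    rw [← div_le_iff₀ hγ]
    unfold minRatio at hc
    linarith
  have hc0 : 0 < c := pos_of_mul_pos_left (lt_of_lt_of_le (by positivity) hcγ) hγ.le
  have hδ : ε / c ≤ √γ := by
    have h4 : ε ≤ 1 / √γ := hεH.le.trans h.height_le
    rw [div_le_iff₀ hc0]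
    refine h4.trans ?_
    rw [div_le_iff₀ hρ]
    calc (1 : ℝ) ≤ c * γ := by linarith
      _ = √γ * c * √γ := by
        conv_lhs => rw [← hρ2]
        ring
  obtain ⟨s, hs, hx, hdist⟩ := h.exists_axis_point (by positivity) hδ
  obtain ⟨u, b, hmin⟩ := exists_isMinimalCap (isCompact_polar hρ h.ball_subset) hx h.norm_eq
  exact ⟨u, b, s • v, hx, ⟨s, hs, rfl⟩, hdist, hmin⟩

end PolarCaps

theorem mainTheorem4 (d : ℕ) (γ : ℝ) (hγ₀ : 0 < γ) (hγ₁ : γ ≤ 1) :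
    ∃ c₀ : ℝ, 0 < c₀ ∧ ∀ c : ℝ, c₀ ≤ c →
    ∃ c₁ c₂ c₃ c₄ : ℝ, 0 < c₁ ∧ 0 < c₂ ∧ 0 < c₃ ∧ 0 < c₄ ∧
    ∀ (K : ConvexBody (EuclideanSpace ℝ (Fin d))),
      PolarCaps.IsCanonical γ (K : Set (EuclideanSpace ℝ (Fin d))) →
    ∀ (v : EuclideanSpace ℝ (Fin d)) (a ε : ℝ), ‖v‖ = 1 → 0 < a → 0 < ε →
      PolarCaps.capWidth (K : Set (EuclideanSpace ℝ (Fin d))) v a = ε →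
      (∃ (u : EuclideanSpace ℝ (Fin d)) (b : ℝ),
        PolarCaps.IsAssociatedCap c ε (K : Set (EuclideanSpace ℝ (Fin d))) v u b) ∧
      ∀ (u : EuclideanSpace ℝ (Fin d)) (b : ℝ),
        PolarCaps.IsAssociatedCap c ε (K : Set (EuclideanSpace ℝ (Fin d))) v u b →
        (∃ z w : EuclideanSpace ℝ (Fin d), z ≠ 0 ∧ w ≠ 0 ∧
          PolarCaps.pointPolar z = PolarCaps.hyperplane v a ∧
          PolarCaps.pointPolar w = PolarCaps.hyperplane u (inner ℝ u z) ∧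
          (c₁ * ε) • PolarCaps.horizontalPolar v
              (PolarCaps.verticalProj v
                (PolarCaps.capBase (PolarCaps.polar (K : Set (EuclideanSpace ℝ (Fin d)))) u b)) ⊆
            (fun p => p - w) '' PolarCaps.capBase (K : Set (EuclideanSpace ℝ (Fin d))) v a ∧
          (fun p => p - w) '' PolarCaps.capBase (K : Set (EuclideanSpace ℝ (Fin d))) v a ⊆
            (c₂ * ε) • PolarCaps.horizontalPolar v
              (PolarCaps.verticalProj v
                (PolarCaps.capBase (PolarCaps.polar (K : Set (EuclideanSpace ℝ (Fin d)))) u b))) ∧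
        c₃ * ε ^ (d + 1) ≤
          MeasureTheory.volume.real (PolarCaps.cap (K : Set (EuclideanSpace ℝ (Fin d))) v a) *
          MeasureTheory.volume.real
            (PolarCaps.cap (PolarCaps.polar (K : Set (EuclideanSpace ℝ (Fin d)))) u b) ∧
        MeasureTheory.volume.real (PolarCaps.cap (K : Set (EuclideanSpace ℝ (Fin d))) v a) *
          MeasureTheory.volume.real
            (PolarCaps.cap (PolarCaps.polar (K : Set (EuclideanSpace ℝ (Fin d)))) u b) ≤
          c₄ * ε ^ (d + 1) := by
  have hκ := PolarCaps.balanceConst_pos d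
  have hρ : 0 < √γ := Real.sqrt_pos.2 hγ₀
  have hρ1 : √γ ≤ 1 := Real.sqrt_le_one.2 hγ₁
  have hρ2 : √γ ^ 2 = γ := Real.sq_sqrt hγ₀.le
  have hpow : 0 < (6 / γ) ^ d := by positivity
  have hfrac : 0 < (8 * (PolarCaps.balanceConst d + 1) + 2 * (6 / γ) ^ d + 2) / γ := by positivity
  have hmin1 : 1 ≤ PolarCaps.minRatio d γ := by unfold PolarCaps.minRatio; linarith
  refine ⟨PolarCaps.minRatio d γ, by linarith, fun c hc => ?_⟩
  have hc1 : 1 ≤ c := hmin1.trans hc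
  have hc0 : 0 < c := by linarith
  have hc8 : 8 * (PolarCaps.balanceConst d + 1) ≤ c * √γ ^ 2 := by
    have h1 : (8 * (PolarCaps.balanceConst d + 1) + 2 * (6 / γ) ^ d + 2) / γ ≤ c := by
      unfold PolarCaps.minRatio at hc; linarith
    rw [div_le_iff₀ hγ₀] at h1
    rw [hρ2]
    linarith
  obtain ⟨c₁, hc₁⟩ : ∃ c₁ : ℝ, c₁ = √γ ^ 7 / (8 * c) := ⟨_, rfl⟩
  obtain ⟨c₂, hc₂⟩ : ∃ c₂ : ℝ, c₂ = 2 / √γ := ⟨_, rfl⟩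
  have hc₁0 : 0 < c₁ := by rw [hc₁]; positivity
  have hc₂0 : 0 < c₂ := by rw [hc₂]; positivity
  have hlow := PolarCaps.volumeProductLower_pos d
  have hup := PolarCaps.volumeProductUpper_pos d
  refine ⟨c₁, c₂, (c₁ / 2) ^ d * (1 / (2 * c₁)) * ((1 / 2) ^ d * (√γ ^ 2 / (2 * c))) *
      PolarCaps.volumeProductLower d, (2 / √γ ^ 2 * c₂) ^ d * (1 / (2 / √γ ^ 2 * c₂)) *
      (2 ^ d * ((PolarCaps.balanceConst d + 1) / √γ ^ 2)) * PolarCaps.volumeProductUpper d,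
    hc₁0, hc₂0, by positivity, by positivity, fun K hK v a ε hv ha hε hwidth => ?_⟩
  obtain ⟨m, H, hsupp, hsup⟩ := hK.exists_isSupported hγ₀ hv
  have haH : a = H - ε := by
    unfold PolarCaps.capWidth at hwidth
    rw [hsup] at hwidth
    linarith
  have hεH : ε < H := by linarith
  refine ⟨hsupp.exists_isAssociatedCap hγ₀ hc hε hεH, fun u b hub => ?_⟩
  obtain ⟨s, η, hthin, hη1, hη2⟩ := hub.exists_isThinCap hγ₀ hc hsupp hε hεH
  have hβ := hthin.inner_axis_pos
  have hηε : √γ * η ≤ ε := hη2.trans (div_le_self hε.le hc1)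
  have hincl1 : ∀ q ∈ (c₁ * ε) • PolarCaps.horizontalPolar v (PolarCaps.verticalProj v
      (PolarCaps.capBase (PolarCaps.polar (K : Set (EuclideanSpace ℝ (Fin d)))) u b)),
      (a / ⟪u, v⟫) • u + q ∈ (K : Set (EuclideanSpace ℝ (Fin d))) := fun q hq =>
    hthin.add_mem_of_mem_horizontalPolar hρ1 hε ha haH hc1 hc8 hη1 hη2 (hc₁ ▸ hq)
  have hincl2 : ∀ p ∈ (K : Set (EuclideanSpace ℝ (Fin d))), ⟪v, p⟫ = a →
      p - (a / ⟪u, v⟫) • u ∈ (c₂ * ε) • PolarCaps.horizontalPolar v (PolarCaps.verticalProj v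
        (PolarCaps.capBase (PolarCaps.polar (K : Set (EuclideanSpace ℝ (Fin d)))) u b)) :=
    fun p hp hpa => hc₂ ▸ hthin.sub_mem_smul_horizontalPolar hε haH hηε hp hpa
  refine ⟨⟨(1 / a) • v, (a / ⟪u, v⟫) • u, ?_, ?_, ?_, ?_, ?_, ?_⟩,
    hthin.volume_product_bounds hρ1 hε ha haH hc1 hc₁0 hc₂0 hη1 hη2 hincl1 hincl2⟩
  · have hv0 : v ≠ 0 := by rintro rfl; simp at hv
    exact smul_ne_zero (by positivity) hv0
  · have hu0 : u ≠ 0 := by rintro rfl; simp at hβ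
    exact smul_ne_zero (by positivity) hu0
  · ext p
    show ⟪(1 / a) • v, p⟫ = 1 ↔ ⟪v, p⟫ = a
    rw [real_inner_smul_left, one_div_mul_eq_div, div_eq_iff ha.ne', one_mul]
  · ext p
    show ⟪(a / ⟪u, v⟫) • u, p⟫ = 1 ↔ ⟪u, p⟫ = ⟪u, (1 / a) • v⟫
    rw [real_inner_smul_left, real_inner_smul_right, one_div_mul_eq_div, eq_div_iff ha.ne',
      div_mul_eq_mul_div, div_eq_iff hβ.ne', one_mul, mul_comm a]
  · intro q hq
    refine ⟨(a / ⟪u, v⟫) • u + q, ⟨?_, hincl1 q hq⟩, by simp⟩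
    obtain ⟨q', hq', rfl⟩ := hq
    show ⟪v, (a / ⟪u, v⟫) • u + (c₁ * ε) • q'⟫ = a
    rw [inner_add_right, real_inner_smul_right, real_inner_smul_right, hq'.1,
      real_inner_comm u v]
    field_simp
    ring
  · rintro _ ⟨p, ⟨hpa, hpK⟩, rfl⟩
    exact hincl2 p hpK hpa
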